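/- For integers $\ell,n\ge 0$ let $\mathcal L_\ell=2^{-\ell}\mathbb Z^3$. An edge of order $\ell$ joins two points of $\mathcal L_\ell$ at distance $2^{-\ell}$. A lattice knot (or link) of order $\ell$ is a finite set of such edges, together with their end points, in which every vertex is incident to exactly two of the edges; it has order $(\ell,n)$ if all its vertices lie in the box $[0,n]^3$. For each square face $F$ (side $2^{-\ell}$) of the cubic honeycomb of $\mathcal L_\ell$, a \emph{tug} on $F$ exchanges one edge of $F$ with the other three edges of $F$, and a \emph{wiggle} on $F$ exchanges two adjacent edges of $F$ with the other two. For each cube of the honeycomb and each edge $h$ of it (the hinge), a \emph{wag} exchanges the three edges different from $h$ of one of the two faces of the cube containing $h$ with the three edges different from $h$ of the other one. Each move is the permutation of the set of lattice knots of order $\ell$ which replaces one of its two patterns by the other in $K$ if $K$ meets (in edges and vertices) the closed face $F$, respectively the union of the two closed faces containing $h$, exactly in that pattern, and which fixes $K$ if $K$ meets this region in neither pattern. Let $\Lambda_\ell$ be the group of permutations generated by all these moves, and $\Lambda_{\ell,n}\le\Lambda_\ell$ the subgroup generated by the tugs and wiggles on faces contained in $[0,n]^3$ and the wags in cubes contained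 in $[0,n]^3$. For a lattice knot $K$ of order $\ell$ let $\rho K$ be the lattice knot of order $\ell+1$ obtained by cutting each edge of $K$ into its two halves. Let $K_1,K_2$ be lattice knots of order $(\ell,n)$. Then the following are equivalent: (a) $K_1\overset{\infty}{\underset{\ell}{\sim}}K_2$: for some integer $n'\ge 0$ there is $g\in\Lambda_{\ell,n+n'}$ with $gK_1=K_2$; (b) $K_1\overset{n}{\underset{\infty}{\sim}}K_2$: for some integer $\ell'\ge 0$ there is $g\in\Lambda_{\ell+\ell',n}$ with $g\rho^{\ell'}K_1=\rho^{\ell'}K_2$; (c) $K_1\sim K_2$: for some integer $m\ge 0$ there is $g\in\Lambda_{\ell+m}$ with $g\rho^{m}K_1=\rho^{m}K_2$. -/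

import Mathlib

namespace LatticeKnots

/-! ### The cubic honeycomb

A point of the lattice of order `ℓ` (all points of `ℝ³` whose coordinates are integer multiples of
`2 ^ (-ℓ)`) is stored through its integer numerators: `a : Point` stands, at order `ℓ`, for the
point with coordinates `a j / 2 ^ ℓ`.  The three coordinates are indexed by `Fin 3 = {0, 1, 2}`. -/

/-- Integer numerators of a lattice point. -/
abbrev Point : Type := Fin 3 → ℤ

/-- The `j`-th coordinate in `ℝ³` of the point of the lattice of order `ℓ` with numerators `a`. -/
noncomputable def coord (ℓ : ℕ) (a : Point) (j : Fin 3) : ℝ := (a j : ℝ) / 2 ^ ℓ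

/-- The step from a lattice point to its neighbour in the `p`-th direction. -/
def step (p : Fin 3) : Point := Pi.single p 1

/-- The pair `(a, p)` is the edge of the honeycomb joining `a` to its neighbour `a + step p`. -/
abbrev Edge : Type := Point × Fin 3

/-- The two end points of an edge. -/
def ends (e : Edge) : Finset Point := {e.1, e.1 + step e.2}

/-- The vertices of a lattice graph (a finite set of edges, together with their end points). -/
def verts (G : Finset Edge) : Finset Point := G.biUnion ends

/-- The valence of the point `v` in the lattice graph `G`. -/
def degree (G : Finset Edge) (v : Point) : ℕ := (G.filter (fun e => v ∈ ends e)).card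

/-- A lattice knot (or link) of order `ℓ`: a `2`-valent lattice graph of order `ℓ`. -/
@[ext] structure LatticeKnot (ℓ : ℕ) where
  edges : Finset Edge
  two_valent : ∀ v ∈ verts edges, degree edges v = 2

/-! ### Local moves -/

/-- `Meets K R A`: the intersection of the lattice graph `K` with the closed subcomplex `R`
(edges and vertices) is exactly the subcomplex `A`. -/
def Meets (K R A : Finset Edge) : Prop := K ∩ R = A ∧ verts K ∩ verts R = verts A

instance (K R A : Finset Edge) : Decidable (Meets K R A) := by
  unfold Meets; infer_instance

/-- The data of a local move: a closed region and two patterns inside it, such that exchanging the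
patterns respects valence. -/
structure Swap where
  region : Finset Edge
  left : Finset Edge
  right : Finset Edge
  left_sub : left ⊆ region
  right_sub : right ⊆ region
  balanced : ∀ v, degree left v = degree right v ∨ (degree left v = 0 ∧ degree right v = 2) ∨
    (degree left v = 2 ∧ degree right v = 0)

/-- The move on lattice graphs: exchange the left and the right pattern if the graph meets the
region exactly in one of them, and do nothing otherwise. -/
def Swap.act (s : Swap) (K : Finset Edge) : Finset Edge :=
  if Meets K s.region s.left then (K \ s.left) ∪ s.right
  else if Meets K s.region s.right then (K \ s.right) ∪ s.left
  else K

theorem mem_verts {G : Finset Edge} {v : Point} : v ∈ verts G ↔ ∃ e ∈ G, v ∈ ends e := by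
  simp [verts]

theorem degree_eq_zero {G : Finset Edge} {v : Point} : degree G v = 0 ↔ v ∉ verts G := by
  simp [degree, mem_verts, Finset.filter_eq_empty_iff]

theorem verts_mono {G H : Finset Edge} (h : G ⊆ H) : verts G ⊆ verts H :=
  Finset.biUnion_subset_biUnion_of_subset_left _ h

theorem degree_union {G H : Finset Edge} (h : Disjoint G H) (v : Point) :
    degree (G ∪ H) v = degree G v + degree H v := by
  unfold degree
  rw [Finset.filter_union, Finset.card_union_of_disjoint]
  exact Finset.disjoint_filter_filter h

theorem degree_sdiff {G H : Finset Edge} (h : H ⊆ G) (v : Point) :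
    degree (G \ H) v + degree H v = degree G v := by
  rw [← degree_union Finset.sdiff_disjoint, Finset.sdiff_union_of_subset h]

theorem exchange {K R A B : Finset Edge} (hB : B ⊆ R)
    (hbal : ∀ v, degree A v = degree B v ∨ (degree A v = 0 ∧ degree B v = 2) ∨
      (degree A v = 2 ∧ degree B v = 0))
    (hK : ∀ v ∈ verts K, degree K v = 2) (hm : Meets K R A) :
    (∀ v ∈ verts ((K \ A) ∪ B), degree ((K \ A) ∪ B) v = 2) ∧ Meets ((K \ A) ∪ B) R B ∧
      (((K \ A) ∪ B) \ B) ∪ A = K := by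
  obtain ⟨h1, h2⟩ := hm
  have hAK : A ⊆ K := h1 ▸ Finset.inter_subset_left
  have hdis : Disjoint (K \ A) B := by
    rw [Finset.disjoint_left]
    intro e he heB
    rw [Finset.mem_sdiff] at he
    exact he.2 (h1 ▸ Finset.mem_inter.2 ⟨he.1, hB heB⟩)
  have hK' : ∀ v, degree K v = 0 ∨ degree K v = 2 := by
    intro v
    by_cases hv : v ∈ verts K
    · exact Or.inr (hK v hv)
    · exact Or.inl (degree_eq_zero.2 hv)
  have hdeg : ∀ v, degree ((K \ A) ∪ B) v + degree A v = degree K v + degree B v := by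
    intro v
    rw [degree_union hdis]
    have := degree_sdiff hAK v
    omega
  have key : ∀ v ∈ verts R, degree A v = 0 → degree K v = 0 := by
    intro v hv h0
    rw [degree_eq_zero] at h0 ⊢
    intro hvK
    exact h0 (h2 ▸ Finset.mem_inter.2 ⟨hvK, hv⟩)
  have hle : ∀ v, degree A v ≤ degree K v := fun v => by
    have := degree_sdiff hAK v
    omega
  refine ⟨?_, ⟨?_, ?_⟩, ?_⟩
  · intro v hv
    have hne : degree ((K \ A) ∪ B) v ≠ 0 := fun h => degree_eq_zero.1 h hv
    have := hdeg v
    have := hle v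
    have hb : degree B v ≠ 0 → degree A v = 0 → degree K v = 0 := by
      intro h3 h4
      refine key v (verts_mono hB ?_) h4
      by_contra h5
      exact h3 (degree_eq_zero.2 h5)
    rcases hbal v with h | ⟨h, h'⟩ | ⟨h, h'⟩ <;> rcases hK' v with h'' | h'' <;> omega
  · ext e
    constructor
    · intro he
      rw [Finset.mem_inter, Finset.mem_union, Finset.mem_sdiff] at he
      rcases he with ⟨⟨h3, h4⟩ | h3, h5⟩
      · exact absurd (h1 ▸ Finset.mem_inter.2 ⟨h3, h5⟩) h4
      · exact h3
    · intro he
      exact Finset.mem_inter.2 ⟨Finset.mem_union_right _ he, hB he⟩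
  · ext v
    constructor
    · intro hv
      rw [Finset.mem_inter] at hv
      by_contra hvB
      have h0 := degree_eq_zero.2 hvB
      have hne : degree ((K \ A) ∪ B) v ≠ 0 := fun h => degree_eq_zero.1 h hv.1
      have := hdeg v
      have := key v hv.2
      rcases hbal v with h | ⟨h, h'⟩ | ⟨h, h'⟩ <;> rcases hK' v with h'' | h'' <;> omega
    · intro hv
      exact Finset.mem_inter.2 ⟨verts_mono Finset.subset_union_right hv, verts_mono hB hv⟩
  · rw [Finset.union_sdiff_cancel_right hdis, Finset.sdiff_union_of_subset hAK]

theorem Swap.balanced' (s : Swap) (v : Point) :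
    degree s.right v = degree s.left v ∨ (degree s.right v = 0 ∧ degree s.left v = 2) ∨
      (degree s.right v = 2 ∧ degree s.left v = 0) := by
  rcases s.balanced v with h | ⟨h, h'⟩ | ⟨h, h'⟩
  · exact Or.inl h.symm
  · exact Or.inr (Or.inr ⟨h', h⟩)
  · exact Or.inr (Or.inl ⟨h', h⟩)

theorem Swap.act_two_valent (s : Swap) {K : Finset Edge}
    (hK : ∀ v ∈ verts K, degree K v = 2) : ∀ v ∈ verts (s.act K), degree (s.act K) v = 2 := by
  unfold Swap.act
  split_ifs with h1 h2
  · exact (exchange s.right_sub s.balanced hK h1).1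
  · exact (exchange s.left_sub s.balanced' hK h2).1
  · exact hK

theorem Swap.act_act (s : Swap) {K : Finset Edge}
    (hK : ∀ v ∈ verts K, degree K v = 2) : s.act (s.act K) = K := by
  by_cases h1 : Meets K s.region s.left
  · obtain ⟨-, h3, h4⟩ := exchange s.right_sub s.balanced hK h1
    have e1 : s.act K = (K \ s.left) ∪ s.right := by rw [Swap.act, if_pos h1]
    by_cases h5 : s.left = s.right
    · have e2 : s.act K = K := by
        rw [e1, ← h5]
        exact Finset.sdiff_union_of_subset (h1.1 ▸ Finset.inter_subset_left)
      rw [e2, e2]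
    · have h6 : ¬ Meets ((K \ s.left) ∪ s.right) s.region s.left :=
        fun h => h5 (h.1.symm.trans h3.1)
      rw [e1, Swap.act, if_neg h6, if_pos h3, h4]
  · by_cases h2 : Meets K s.region s.right
    · obtain ⟨-, h3, h4⟩ := exchange s.left_sub s.balanced' hK h2
      have e1 : s.act K = (K \ s.right) ∪ s.left := by rw [Swap.act, if_neg h1, if_pos h2]
      rw [e1, Swap.act, if_pos h3, h4]
    · have e1 : s.act K = K := by rw [Swap.act, if_neg h1, if_neg h2]
      rw [e1, e1]

/-- A local move as a permutation of the set of lattice knots of order `ℓ`. -/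
def Swap.perm (ℓ : ℕ) (s : Swap) : Equiv.Perm (LatticeKnot ℓ) where
  toFun K := ⟨s.act K.edges, s.act_two_valent K.two_valent⟩
  invFun K := ⟨s.act K.edges, s.act_two_valent K.two_valent⟩
  left_inv K := LatticeKnot.ext (s.act_act K.two_valent)
  right_inv K := LatticeKnot.ext (s.act_act K.two_valent)

/-! ### Tug, wiggle and wag -/

/-- The four corners, in counterclockwise order starting at `a`, of the face with preferred vertex
`a` perpendicular to the direction `p`; it is spanned by the directions `p + 1` and `p + 2`
(cyclically). -/
def corner (a : Point) (p : Fin 3) : Fin 4 → Point :=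
  ![a, a + step (p + 1), a + step (p + 1) + step (p + 2), a + step (p + 2)]

/-- The four edges of that face: the edge `q` joins the corners `q` and `q + 1` (cyclically). -/
def faceEdge (a : Point) (p : Fin 3) : Fin 4 → Edge :=
  ![(a, p + 1), (a + step (p + 1), p + 2), (a + step (p + 2), p + 1), (a, p + 2)]

/-- The edge perpendicular to that face at the corner `q`, on the side of the cube with preferred
vertex `a`. -/
def hinge (a : Point) (p : Fin 3) (q : Fin 4) : Edge := (corner a p q, p)

/-- All four edges of the face. -/
def faceRegion (a : Point) (p : Fin 3) (q : Fin 4) : Finset Edge :=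
  {faceEdge a p q, faceEdge a p (q + 1), faceEdge a p (q + 2), faceEdge a p (q + 3)}

/-- The three edges other than the hinge `q` of one of the two faces of the cube that contain this
hinge, namely of the one on the edge `faceEdge a p q`. -/
def wagLeft (a : Point) (p : Fin 3) (q : Fin 4) : Finset Edge :=
  {faceEdge a p q, hinge a p (q + 1), faceEdge (a + step p) p q}

/-- The three edges other than the hinge `q` of the other face of the cube that contains it. -/
def wagRight (a : Point) (p : Fin 3) (q : Fin 4) : Finset Edge :=
  {faceEdge a p (q + 3), hinge a p (q + 3), faceEdge (a + step p) p (q + 3)}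

/-- The union of the boundaries of the two faces of the cube that contain the hinge `q`. -/
def wagRegion (a : Point) (p : Fin 3) (q : Fin 4) : Finset Edge :=
  insert (hinge a p q) (wagLeft a p q ∪ wagRight a p q)

theorem faceEdge_ends (a : Point) (p : Fin 3) (q : Fin 4) :
    ends (faceEdge a p q) = {corner a p q, corner a p (q + 1)} := by
  fin_cases q <;> simp [ends, faceEdge, corner, Finset.pair_comm, add_right_comm]

/-- Translation of an edge. -/
def shift (a : Point) (e : Edge) : Edge := (a + e.1, e.2)

theorem shift_injective (a : Point) : Function.Injective (shift a) := by
  rintro ⟨x, p⟩ ⟨y, q⟩ h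
  simpa [shift] using h

theorem degree_shift (a : Point) (G : Finset Edge) (v : Point) :
    degree (G.image (shift a)) v = degree G (v - a) := by
  unfold degree
  rw [Finset.filter_image, Finset.card_image_of_injective _ (shift_injective a)]
  congr 1
  ext e
  simp only [Finset.mem_filter, ends, shift, Finset.mem_insert, Finset.mem_singleton,
    sub_eq_iff_eq_add, add_comm a, add_right_comm]

theorem faceEdge_shift (a b : Point) (p : Fin 3) (q : Fin 4) :
    shift a (faceEdge b p q) = faceEdge (a + b) p q := by
  fin_cases q <;> simp [shift, faceEdge, add_assoc]

theorem hinge_shift (a b : Point) (p : Fin 3) (q : Fin 4) :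
    shift a (hinge b p q) = hinge (a + b) p q := by
  fin_cases q <;> simp [shift, hinge, corner, add_assoc]

theorem balanced_shift {a : Point} {R A B A' B' : Finset Edge}
    (hA' : A' = A.image (shift a)) (hB' : B' = B.image (shift a))
    (hA : A ⊆ R) (hB : B ⊆ R)
    (h : ∀ v ∈ verts R, degree A v = degree B v ∨ (degree A v = 0 ∧ degree B v = 2) ∨
      (degree A v = 2 ∧ degree B v = 0)) (v : Point) :
    degree A' v = degree B' v ∨ (degree A' v = 0 ∧ degree B' v = 2) ∨
      (degree A' v = 2 ∧ degree B' v = 0) := by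
  subst hA' hB'
  rw [degree_shift, degree_shift]
  by_cases hv : v - a ∈ verts R
  · exact h _ hv
  · left
    rw [degree_eq_zero.2 fun h' => hv (verts_mono hA h'),
      degree_eq_zero.2 fun h' => hv (verts_mono hB h')]

/-- The tug: a single edge `q` of the face is exchanged with the other three. -/
def tugSwap (a : Point) (p : Fin 3) (q : Fin 4) : Swap where
  region := faceRegion a p q
  left := {faceEdge a p q}
  right := {faceEdge a p (q + 1), faceEdge a p (q + 2), faceEdge a p (q + 3)}
  left_sub := by simp [faceRegion]
  right_sub := by simp [faceRegion]
  balanced := balanced_shift (a := a) (R := faceRegion 0 p q) (A := {faceEdge 0 p q})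
    (B := {faceEdge 0 p (q + 1), faceEdge 0 p (q + 2), faceEdge 0 p (q + 3)})
    (by simp [faceEdge_shift]) (by simp [faceEdge_shift, Finset.image_insert])
    (by simp [faceRegion]) (by simp [faceRegion]) (by revert p q; decide)

/-- The wiggle: the two edges of the face on one side of a diagonal are exchanged with the two on
the other side.  (The diagonals of `q` and `q + 2` are the same.) -/
def wiggleSwap (a : Point) (p : Fin 3) (q : Fin 4) : Swap where
  region := faceRegion a p q
  left := {faceEdge a p q, faceEdge a p (q + 3)}
  right := {faceEdge a p (q + 1), faceEdge a p (q + 2)}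
  left_sub := by simp [faceRegion, Finset.insert_subset_iff]
  right_sub := by simp [faceRegion, Finset.insert_subset_iff]
  balanced := balanced_shift (a := a) (R := faceRegion 0 p q)
    (A := {faceEdge 0 p q, faceEdge 0 p (q + 3)})
    (B := {faceEdge 0 p (q + 1), faceEdge 0 p (q + 2)})
    (by simp [faceEdge_shift, Finset.image_insert])
    (by simp [faceEdge_shift, Finset.image_insert])
    (by simp [faceRegion, Finset.insert_subset_iff])
    (by simp [faceRegion, Finset.insert_subset_iff]) (by revert p q; decide)

/-- The wag: three edges of a face of the cube are swung around the fourth one, the hinge, to the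
other face of the cube that contains the hinge. -/
def wagSwap (a : Point) (p : Fin 3) (q : Fin 4) : Swap where
  region := wagRegion a p q
  left := wagLeft a p q
  right := wagRight a p q
  left_sub := Finset.subset_union_left.trans (Finset.subset_insert _ _)
  right_sub := Finset.subset_union_right.trans (Finset.subset_insert _ _)
  balanced := balanced_shift (a := a) (R := wagRegion 0 p q) (A := wagLeft 0 p q)
    (B := wagRight 0 p q)
    (by simp [wagLeft, faceEdge_shift, hinge_shift, Finset.image_insert])
    (by simp [wagRight, faceEdge_shift, hinge_shift, Finset.image_insert])
    (Finset.subset_union_left.trans (Finset.subset_insert _ _))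
    (Finset.subset_union_right.trans (Finset.subset_insert _ _)) (by revert p q; decide)

def tug (ℓ : ℕ) (a : Point) (p : Fin 3) (q : Fin 4) : Equiv.Perm (LatticeKnot ℓ) :=
  (tugSwap a p q).perm ℓ

def wiggle (ℓ : ℕ) (a : Point) (p : Fin 3) (q : Fin 4) : Equiv.Perm (LatticeKnot ℓ) :=
  (wiggleSwap a p q).perm ℓ

def wag (ℓ : ℕ) (a : Point) (p : Fin 3) (q : Fin 4) : Equiv.Perm (LatticeKnot ℓ) :=
  (wagSwap a p q).perm ℓ

/-- The lattice ambient group of order `ℓ`. -/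
def ambientGroup (ℓ : ℕ) : Subgroup (Equiv.Perm (LatticeKnot ℓ)) :=
  Subgroup.closure {g | ∃ a p q, g = tug ℓ a p q ∨ g = wiggle ℓ a p q ∨ g = wag ℓ a p q}

/-! ### Refinement and lattice knot type -/

/-- Each edge is cut into its two halves; the point with numerators `a` at order `ℓ` has numerators
`2 * a` at order `ℓ + 1`. -/
def refineEdges (G : Finset Edge) : Finset Edge :=
  G.biUnion fun e => {((2 : ℤ) • e.1, e.2), ((2 : ℤ) • e.1 + step e.2, e.2)}

theorem mem_refineEdges {G : Finset Edge} {x : Point} {p : Fin 3} :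
    (x, p) ∈ refineEdges G ↔
      ∃ a, (a, p) ∈ G ∧ (x = (2 : ℤ) • a ∨ x = (2 : ℤ) • a + step p) := by
  simp only [refineEdges, Finset.mem_biUnion, Finset.mem_insert, Finset.mem_singleton,
    Prod.mk.injEq, Prod.exists]
  constructor
  · rintro ⟨a, r, h, ⟨rfl, rfl⟩ | ⟨rfl, rfl⟩⟩
    · exact ⟨a, h, Or.inl rfl⟩
    · exact ⟨a, h, Or.inr rfl⟩
  · rintro ⟨a, h, rfl | rfl⟩
    · exact ⟨a, p, h, Or.inl ⟨rfl, rfl⟩⟩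
    · exact ⟨a, p, h, Or.inr ⟨rfl, rfl⟩⟩

theorem mem_ends {v x : Point} {p : Fin 3} : v ∈ ends (x, p) ↔ v = x ∨ v = x + step p := by
  simp [ends]

theorem two_smul_injective {a b : Point} (h : (2 : ℤ) • a = (2 : ℤ) • b) : a = b := by
  funext j
  have := congr_fun h j
  simp at this
  exact this

theorem even_ne_odd {a b : Point} {p : Fin 3} : (2 : ℤ) • a ≠ (2 : ℤ) • b + step p := by
  intro h
  have := congr_fun h p
  simp [step] at this
  omega

theorem two_step (p : Fin 3) : step p + step p = (2 : ℤ) • step p := (two_smul ℤ _).symm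

theorem odd_eq_odd {a b : Point} {p q : Fin 3}
    (h : (2 : ℤ) • a + step p = (2 : ℤ) • b + step q) : a = b ∧ p = q := by
  have hpq : p = q := by
    by_contra hne
    have := congr_fun h p
    simp [step, hne] at this
    omega
  subst hpq
  exact ⟨two_smul_injective (add_right_cancel h), rfl⟩

theorem refine_two_valent {G : Finset Edge} (hG : ∀ v ∈ verts G, degree G v = 2) :
    ∀ v ∈ verts (refineEdges G), degree (refineEdges G) v = 2 := by
  intro v hv
  have hcase : (∃ w ∈ verts G, v = (2 : ℤ) • w) ∨
      ∃ a p, (a, p) ∈ G ∧ v = (2 : ℤ) • a + step p := by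
    obtain ⟨⟨x, p⟩, hx, hvx⟩ := mem_verts.1 hv
    obtain ⟨a, ha, rfl | rfl⟩ := mem_refineEdges.1 hx
    · rcases mem_ends.1 hvx with rfl | rfl
      · exact Or.inl ⟨a, mem_verts.2 ⟨_, ha, mem_ends.2 (Or.inl rfl)⟩, rfl⟩
      · exact Or.inr ⟨a, p, ha, rfl⟩
    · rcases mem_ends.1 hvx with rfl | rfl
      · exact Or.inr ⟨a, p, ha, rfl⟩
      · refine Or.inl ⟨a + step p, mem_verts.2 ⟨_, ha, mem_ends.2 (Or.inr rfl)⟩, ?_⟩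
        rw [add_assoc, two_step, smul_add]
  rcases hcase with ⟨w, hw, rfl⟩ | ⟨a, p, ha, rfl⟩
  · rw [← hG w hw]
    unfold degree
    symm
    refine Finset.card_bij
      (fun e _ => if w = e.1 then ((2 : ℤ) • e.1, e.2) else ((2 : ℤ) • e.1 + step e.2, e.2))
      ?_ ?_ ?_
    · rintro ⟨x, p⟩ he
      rw [Finset.mem_filter, mem_ends] at he
      by_cases hwx : w = x
      · subst hwx
        rw [if_pos rfl, Finset.mem_filter, mem_refineEdges, mem_ends]
        exact ⟨⟨w, he.1, Or.inl rfl⟩, Or.inl rfl⟩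
      · simp only [hwx, if_false, Finset.mem_filter, mem_refineEdges, mem_ends]
        refine ⟨⟨x, he.1, Or.inr rfl⟩, Or.inr ?_⟩
        rw [he.2.resolve_left hwx, add_assoc, two_step, smul_add]
    · rintro ⟨x, p⟩ - ⟨y, q⟩ - h
      simp only at h
      split_ifs at h with h1 h2 h2
      · rw [Prod.mk.injEq] at h ⊢
        exact ⟨h1.symm.trans h2, h.2⟩
      · rw [Prod.mk.injEq] at h
        exact absurd h.1 even_ne_odd
      · rw [Prod.mk.injEq] at h
        exact absurd h.1.symm even_ne_odd
      · rw [Prod.mk.injEq] at h ⊢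
        exact odd_eq_odd h.1
    · rintro ⟨x, p⟩ he
      rw [Finset.mem_filter, mem_refineEdges, mem_ends] at he
      obtain ⟨⟨a, ha, rfl | rfl⟩, h2⟩ := he
      · rcases h2 with h2 | h2
        · have := two_smul_injective h2
          subst this
          exact ⟨(w, p), Finset.mem_filter.2 ⟨ha, mem_ends.2 (Or.inl rfl)⟩, by simp⟩
        · exact absurd h2 even_ne_odd
      · rcases h2 with h2 | h2
        · exact absurd h2 even_ne_odd
        · rw [add_assoc, two_step, ← smul_add] at h2
          have := two_smul_injective h2
          subst this
          refine ⟨(a, p), Finset.mem_filter.2 ⟨ha, mem_ends.2 (Or.inr rfl)⟩, ?_⟩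
          have hne : a + step p ≠ a := by
            intro h
            have := congr_fun h p
            simp [step] at this
          simp only [hne, if_false]
  · have : (refineEdges G).filter (fun e => (2 : ℤ) • a + step p ∈ ends e) =
        {((2 : ℤ) • a, p), ((2 : ℤ) • a + step p, p)} := by
      ext ⟨x, q⟩
      simp only [Finset.mem_filter, mem_refineEdges, mem_ends, Finset.mem_insert,
        Finset.mem_singleton, Prod.mk.injEq]
      constructor
      · rintro ⟨⟨b, hb, rfl | rfl⟩, h | h⟩
        · exact absurd h.symm even_ne_odd
        · obtain ⟨rfl, rfl⟩ := odd_eq_odd h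
          exact Or.inl ⟨rfl, rfl⟩
        · obtain ⟨rfl, rfl⟩ := odd_eq_odd h
          exact Or.inr ⟨rfl, rfl⟩
        · rw [add_assoc, two_step, ← smul_add] at h
          exact absurd h.symm even_ne_odd
      · rintro (⟨rfl, rfl⟩ | ⟨rfl, rfl⟩)
        · exact ⟨⟨a, ha, Or.inl rfl⟩, Or.inr rfl⟩
        · exact ⟨⟨a, ha, Or.inr rfl⟩, Or.inl rfl⟩
    unfold degree
    rw [this, Finset.card_pair]
    intro h
    rw [Prod.mk.injEq] at h
    exact even_ne_odd h.1

/-- The refinement injection: the same knot, viewed in the honeycomb of the next order. -/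
def refine {ℓ : ℕ} (K : LatticeKnot ℓ) : LatticeKnot (ℓ + 1) :=
  ⟨refineEdges K.edges, refine_two_valent K.two_valent⟩

/-- The `m`-fold refinement. -/
def refinePow {ℓ : ℕ} (K : LatticeKnot ℓ) : (m : ℕ) → LatticeKnot (ℓ + m)
  | 0 => K
  | m + 1 => refine (refinePow K m)

/-- Same knot `ℓ`-type. -/
def SameTypeAt {ℓ : ℕ} (K₁ K₂ : LatticeKnot ℓ) : Prop := ∃ g ∈ ambientGroup ℓ, g K₁ = K₂

/-- Same (lattice) knot type: same knot `(ℓ + m)`-type after `m` refinements, for some `m`. -/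
def SameKnotType {ℓ : ℕ} (K₁ K₂ : LatticeKnot ℓ) : Prop :=
  ∃ m : ℕ, SameTypeAt (refinePow K₁ m) (refinePow K₂ m)

/-! ### Bounded lattice knots -/

/-- Membership in the `n`-bounded lattice of order `ℓ`, i.e. in the box `[0, n]³`. -/
def InBox (ℓ n : ℕ) (a : Point) : Prop := ∀ j, 0 ≤ coord ℓ a j ∧ coord ℓ a j ≤ n

/-- A bounded lattice knot of order `(ℓ, n)`: a lattice knot of order `ℓ` lying in the box. -/
@[ext] structure BoundedKnot (ℓ n : ℕ) where
  toKnot : LatticeKnot ℓ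
  inBox : ∀ v ∈ verts toKnot.edges, InBox ℓ n v

/-- All four corners of the face with preferred vertex `a` perpendicular to the direction `p` lie in
the box `[0, n]³`. -/
def FaceInBox (ℓ n : ℕ) (a : Point) (p : Fin 3) : Prop :=
  (0 ≤ coord ℓ a p ∧ coord ℓ a p ≤ n) ∧
  (0 ≤ coord ℓ a (p + 1) ∧ coord ℓ a (p + 1) ≤ n - 1 / 2 ^ ℓ) ∧
  (0 ≤ coord ℓ a (p + 2) ∧ coord ℓ a (p + 2) ≤ n - 1 / 2 ^ ℓ)

/-- The cube with preferred vertex `a` lies in the box `[0, n]³`. -/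
def CubeInBox (ℓ n : ℕ) (a : Point) : Prop :=
  ∀ j, 0 ≤ coord ℓ a j ∧ coord ℓ a j ≤ n - 1 / 2 ^ ℓ

/-- The bounded ambient group of order `(ℓ, n)`: generated by the tugs and wiggles on the faces in
the box and by the wags on the cubes in the box. -/
def boundedAmbientGroup (ℓ n : ℕ) : Subgroup (Equiv.Perm (LatticeKnot ℓ)) :=
  Subgroup.closure
    {g | (∃ a p q, FaceInBox ℓ n a p ∧ (g = tug ℓ a p q ∨ g = wiggle ℓ a p q)) ∨
      (∃ a p q, CubeInBox ℓ n a ∧ g = wag ℓ a p q)}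

theorem boundedAmbientGroup_le (ℓ n : ℕ) : boundedAmbientGroup ℓ n ≤ ambientGroup ℓ := by
  refine Subgroup.closure_mono ?_
  rintro g (⟨a, p, q, -, h | h⟩ | ⟨a, p, q, -, h⟩)
  · exact ⟨a, p, q, Or.inl h⟩
  · exact ⟨a, p, q, Or.inr (Or.inl h)⟩
  · exact ⟨a, p, q, Or.inr (Or.inr h)⟩

/-- The lattice knot injection: the same knot in the next larger box. -/
def iota {ℓ n : ℕ} (K : BoundedKnot ℓ n) : BoundedKnot ℓ (n + 1) :=
  ⟨K.toKnot, fun v hv j => ⟨(K.inBox v hv j).1,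
    (K.inBox v hv j).2.trans (Nat.cast_le.2 (Nat.le_succ n))⟩⟩

/-- The `k`-fold iterate of the lattice knot injection. -/
def iotaPow {ℓ n : ℕ} (K : BoundedKnot ℓ n) : (k : ℕ) → BoundedKnot ℓ (n + k)
  | 0 => K
  | k + 1 => iota (iotaPow K k)

theorem coord_two_smul (ℓ : ℕ) (a : Point) (j : Fin 3) :
    coord (ℓ + 1) ((2 : ℤ) • a) j = coord ℓ a j := by
  simp only [coord, Pi.smul_apply, smul_eq_mul, Int.cast_mul, Int.cast_ofNat, pow_succ]
  field_simp

theorem inBox_mid {ℓ n : ℕ} {a : Point} {p : Fin 3} (h0 : InBox ℓ n a)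
    (h1 : InBox ℓ n (a + step p)) : InBox (ℓ + 1) n ((2 : ℤ) • a + step p) := by
  intro j
  have e : coord (ℓ + 1) ((2 : ℤ) • a + step p) j =
      (coord ℓ a j + coord ℓ (a + step p) j) / 2 := by
    simp only [coord, Pi.add_apply, Pi.smul_apply, smul_eq_mul, Int.cast_add, Int.cast_mul,
      Int.cast_ofNat, pow_succ]
    field_simp
    ring
  have := h0 j
  have := h1 j
  constructor <;> linarith

theorem inBox_refine {ℓ n : ℕ} {G : Finset Edge} (h : ∀ v ∈ verts G, InBox ℓ n v) :
    ∀ v ∈ verts (refineEdges G), InBox (ℓ + 1) n v := by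
  intro v hv
  obtain ⟨⟨x, p⟩, hx, hvx⟩ := mem_verts.1 hv
  obtain ⟨a, ha, hxa⟩ := mem_refineEdges.1 hx
  have h0 : InBox ℓ n a := h a (mem_verts.2 ⟨_, ha, mem_ends.2 (Or.inl rfl)⟩)
  have h1 : InBox ℓ n (a + step p) := h _ (mem_verts.2 ⟨_, ha, mem_ends.2 (Or.inr rfl)⟩)
  have hd : ∀ w, InBox ℓ n w → InBox (ℓ + 1) n ((2 : ℤ) • w) := by
    intro w hw j
    rw [coord_two_smul]
    exact hw j
  rcases hxa with rfl | rfl <;> rcases mem_ends.1 hvx with rfl | rfl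
  · exact hd a h0
  · exact inBox_mid h0 h1
  · exact inBox_mid h0 h1
  · rw [add_assoc, two_step, ← smul_add]
    exact hd _ h1

/-- The refinement injection on bounded lattice knots; the box stays the same. -/
def BoundedKnot.refine {ℓ n : ℕ} (K : BoundedKnot ℓ n) : BoundedKnot (ℓ + 1) n :=
  ⟨LatticeKnots.refine K.toKnot, inBox_refine K.inBox⟩

/-- The `k`-fold refinement of bounded lattice knots. -/
def BoundedKnot.refinePow {ℓ n : ℕ} (K : BoundedKnot ℓ n) : (k : ℕ) → BoundedKnot (ℓ + k) n
  | 0 => K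
  | k + 1 => (BoundedKnot.refinePow K k).refine

/-- Same bounded knot `(ℓ, n)`-type. -/
def SameBoundedType {ℓ n : ℕ} (K₁ K₂ : BoundedKnot ℓ n) : Prop :=
  ∃ g ∈ boundedAmbientGroup ℓ n, g K₁.toKnot = K₂.toKnot

/-- Same knot `(ℓ, ∞)`-type: same bounded type at the same order in some larger box. -/
def SameTypeBoxLimit {ℓ n : ℕ} (K₁ K₂ : BoundedKnot ℓ n) : Prop :=
  ∃ n' : ℕ, SameBoundedType (iotaPow K₁ n') (iotaPow K₂ n')

/-- Same knot `(∞, n)`-type: same bounded type in the same box after some number of refinements. -/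
def SameTypeOrderLimit {ℓ n : ℕ} (K₁ K₂ : BoundedKnot ℓ n) : Prop :=
  ∃ ℓ' : ℕ, SameBoundedType (K₁.refinePow ℓ') (K₂.refinePow ℓ')

end LatticeKnots

/-! Written in numerators, a move does not see the order `ℓ`: tugs, wiggles and wags act on finite
sets of edges of the integer lattice, and order and box enter only through the side `n * 2 ^ ℓ` of
the box of numerators. Each of the three relations thus says that two graphs are joined by a
sequence of moves (`Reach`) in some region, and the theorem is a comparison of regions.

The crucial fact is that a graph and its refinement, read in the same lattice, are joined by moves
in the box of the refinement (`reach_refineEdges`). Doubling all coordinates amounts to inserting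
empty layers one at a time, and an empty layer can be moved through a graph. If the layer `c + 1`
carries no edge of its own and is only crossed by edges in direction `p`, the edges inside the layer
`c` can be pushed across one by one. Each push adds the boundary of a face modulo two and is a tug
or a wiggle (`exists_act_eq_symmDiff`, `Mergeable.exists_reach`). Afterwards the layer `c` is the
empty one (`reach_stretch_succ`). Starting beyond the graph, the empty layer can be brought to any
position (`reach_stretch`); bringing it below the whole graph translates the graph by one step.

From box limit to order limit: refine until the fixed box has enough numerators to contain the given
moves, and join each knot to its refinement inside that box. From order limit to knot type: the
bounded group is a subgroup. From knot type to box limit: a group element is a finite word in the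
moves, so its moves stay in some cube centred at the origin. Replace the refinements by the knots
themselves, translate the whole sequence into the positive octant, and join each knot to its
translate by moves. Wags are never needed to build a path; they only occur in paths that are given.
-/

namespace LatticeKnots

/-! ### Flipping a face -/

/-- Every vertex of the lattice graph is incident to exactly two of its edges. -/
def TwoValent (G : Finset Edge) : Prop := ∀ v ∈ verts G, degree G v = 2

theorem TwoValent.act {K : Finset Edge} (hK : TwoValent K) (s : Swap) : TwoValent (s.act K) :=
  s.act_two_valent hK

/-- When the two patterns are complementary in the region, exchanging them in either direction is
the same operation: addition of the region modulo two. This applies to tugs and wiggles but not to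
wags, whose region also contains the hinge. -/
theorem Swap.act_eq_symmDiff (s : Swap) {K : Finset Edge}
    (hl : s.left = s.region \ s.right) (hr : s.right = s.region \ s.left)
    (hm : Meets K s.region s.left ∨ Meets K s.region s.right) :
    s.act K = symmDiff K s.region := by
  have key : ∀ A B : Finset Edge, B = s.region \ A → K ∩ s.region = A →
      (K \ A) ∪ B = symmDiff K s.region := by
    rintro A B rfl rfl
    ext e
    simp only [Finset.mem_union, Finset.mem_sdiff, Finset.mem_inter, Finset.mem_symmDiff]
    tauto
  unfold Swap.act
  split_ifs with h1 h2
  · exact key _ _ hr h1.1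
  · exact key _ _ hl h2.1
  · tauto

/-- Translation to the origin leaves a finite check. -/
theorem faceEdge_injective (a : Point) (p : Fin 3) : Function.Injective (faceEdge a p) := by
  intro q q' h
  have h0 : faceEdge 0 p q = faceEdge 0 p q' := by
    apply shift_injective a
    rwa [faceEdge_shift, faceEdge_shift, add_zero]
  clear h
  revert p q q'
  decide

theorem mem_faceRegion {a : Point} {p : Fin 3} {q : Fin 4} {e : Edge} :
    e ∈ faceRegion a p q ↔ ∃ i, e = faceEdge a p i := by
  simp only [faceRegion, Finset.mem_insert, Finset.mem_singleton]
  constructor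
  · rintro (h | h | h | h) <;> exact ⟨_, h⟩
  · rintro ⟨i, rfl⟩
    simp only [(faceEdge_injective a p).eq_iff]
    revert i q
    decide

/-- The index only chooses the edge with which the enumeration starts; moves with different indices
can thus be compared as additions of one and the same set. -/
theorem faceRegion_eq (a : Point) (p : Fin 3) (q q' : Fin 4) :
    faceRegion a p q = faceRegion a p q' := by
  ext e
  rw [mem_faceRegion, mem_faceRegion]

theorem tug_act_eq {K : Finset Edge} {a : Point} {p : Fin 3} {q : Fin 4}
    (hm : Meets K (faceRegion a p q) {faceEdge a p q} ∨
      Meets K (faceRegion a p q) {faceEdge a p (q + 1), faceEdge a p (q + 2),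
        faceEdge a p (q + 3)}) :
    (tugSwap a p q).act K = symmDiff K (faceRegion a p q) := by
  have hi : ∀ {x y}, faceEdge a p x = faceEdge a p y ↔ x = y := (faceEdge_injective a p).eq_iff
  refine Swap.act_eq_symmDiff _ ?_ ?_ hm
  all_goals
    ext e
    simp only [tugSwap, faceRegion, Finset.mem_sdiff, Finset.mem_insert, Finset.mem_singleton]
    constructor
    · first
      | rintro rfl
        simp only [hi]
        clear * - q; revert q; decide
      | rintro (rfl | rfl | rfl) <;> simp only [hi] <;> (clear * - q; revert q; decide)
    · tauto

theorem wiggle_act_eq {K : Finset Edge} {a : Point} {p : Fin 3} {q : Fin 4}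
    (hm : Meets K (faceRegion a p q) {faceEdge a p q, faceEdge a p (q + 3)} ∨
      Meets K (faceRegion a p q) {faceEdge a p (q + 1), faceEdge a p (q + 2)}) :
    (wiggleSwap a p q).act K = symmDiff K (faceRegion a p q) := by
  have hi : ∀ {x y}, faceEdge a p x = faceEdge a p y ↔ x = y := (faceEdge_injective a p).eq_iff
  refine Swap.act_eq_symmDiff _ ?_ ?_ hm
  all_goals
    ext e
    simp only [wiggleSwap, faceRegion, Finset.mem_sdiff, Finset.mem_insert, Finset.mem_singleton]
    constructor
    · rintro (rfl | rfl) <;> simp only [hi] <;> (clear * - q; revert q; decide)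
    · tauto

theorem verts_insert (e : Edge) (G : Finset Edge) : verts (insert e G) = ends e ∪ verts G := by
  simp [verts, Finset.biUnion_insert]

theorem verts_singleton (e : Edge) : verts {e} = ends e := by
  simp [verts]

/-- If the graph runs through the edge `i` of a face, not through the opposite edge, and if at each
of the two remaining corners the graph either avoids the corner or runs through the edge joining it
to the edge `i`, then a tug or a wiggle adds the boundary of the face modulo two. -/
theorem exists_act_eq_symmDiff {K : Finset Edge} {a : Point} {p : Fin 3} {i : Fin 4}
    (h0 : faceEdge a p i ∈ K) (h2 : faceEdge a p (i + 2) ∉ K)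
    (h1 : faceEdge a p (i + 1) ∈ K ∨ corner a p (i + 2) ∉ verts K)
    (h3 : faceEdge a p (i + 3) ∈ K ∨ corner a p (i + 3) ∉ verts K) :
    ∃ q, symmDiff K (faceRegion a p i) = (tugSwap a p q).act K ∨
      symmDiff K (faceRegion a p i) = (wiggleSwap a p q).act K := by
  have e11 : i + 1 + 1 = i + 2 := by clear * - i; revert i; decide
  have e12 : i + 1 + 2 = i + 3 := by clear * - i; revert i; decide
  have e13 : i + 1 + 3 = i := by clear * - i; revert i; decide
  have e21 : i + 2 + 1 = i + 3 := by clear * - i; revert i; decide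
  have e22 : i + 2 + 2 = i := by clear * - i; revert i; decide
  have e23 : i + 2 + 3 = i + 1 := by clear * - i; revert i; decide
  have e31 : i + 3 + 1 = i := by clear * - i; revert i; decide
  have c0 : corner a p i ∈ verts K :=
    mem_verts.2 ⟨_, h0, by rw [faceEdge_ends]; simp⟩
  have c1 : corner a p (i + 1) ∈ verts K :=
    mem_verts.2 ⟨_, h0, by rw [faceEdge_ends]; simp⟩
  have c12 : faceEdge a p (i + 1) ∈ K → corner a p (i + 2) ∈ verts K := fun h =>
    mem_verts.2 ⟨_, h, by rw [faceEdge_ends, e11]; simp⟩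
  have c33 : faceEdge a p (i + 3) ∈ K → corner a p (i + 3) ∈ verts K := fun h =>
    mem_verts.2 ⟨_, h, by rw [faceEdge_ends]; simp⟩
  -- A candidate pattern has to agree with `K` on the edges of the face and also on its corners. The
  -- corners `i` and `i + 1` lie on `K` because of the edge `i`; only the other two corners need an
  -- assumption.
  have meets : ∀ A : Finset Edge,
      (∀ e ∈ faceRegion a p i, e ∈ A ↔ e ∈ K) → A ⊆ faceRegion a p i →
      (corner a p i ∈ verts A ∧ corner a p (i + 1) ∈ verts A) →
      (corner a p (i + 2) ∈ verts K → corner a p (i + 2) ∈ verts A) →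
      (corner a p (i + 3) ∈ verts K → corner a p (i + 3) ∈ verts A) →
      Meets K (faceRegion a p i) A := by
    intro A hA hAR hc hc2 hc3
    have hAK : A ⊆ K := fun e he => (hA e (hAR he)).1 he
    constructor
    · ext e
      rw [Finset.mem_inter]
      exact ⟨fun h => (hA e h.2).2 h.1, fun h => ⟨hAK h, hAR h⟩⟩
    · refine Finset.Subset.antisymm ?_
        (Finset.subset_inter (verts_mono hAK) (verts_mono hAR))
      intro v hv
      rw [Finset.mem_inter] at hv
      obtain ⟨hvK, hvR⟩ := hv
      simp only [faceRegion, verts_insert, verts_singleton, faceEdge_ends, e11, e21, e31,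
        Finset.mem_union, Finset.mem_insert, Finset.mem_singleton] at hvR
      rcases hvR with (rfl | rfl) | (rfl | rfl) | (rfl | rfl) | (rfl | rfl)
      exacts [hc.1, hc.2, hc.2, hc2 hvK, hc2 hvK, hc3 hvK, hc3 hvK, hc.1]
  have hreg : ∀ P : Edge → Prop, P (faceEdge a p i) → P (faceEdge a p (i + 1)) →
      P (faceEdge a p (i + 2)) → P (faceEdge a p (i + 3)) → ∀ e ∈ faceRegion a p i, P e := by
    intro P p0 p1 p2 p3 e he
    simp only [faceRegion, Finset.mem_insert, Finset.mem_singleton] at he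
    rcases he with rfl | rfl | rfl | rfl <;> assumption
  have hi := fun x y => (faceEdge_injective a p).eq_iff (a := x) (b := y)
  have d01 : i ≠ i + 1 := by clear * - i; revert i; decide
  have d02 : i ≠ i + 2 := by clear * - i; revert i; decide
  have d03 : i ≠ i + 3 := by clear * - i; revert i; decide
  have d12 : i + 1 ≠ i + 2 := by clear * - i; revert i; decide
  have d13 : i + 1 ≠ i + 3 := by clear * - i; revert i; decide
  have d23 : i + 2 ≠ i + 3 := by clear * - i; revert i; decide
  -- The graph contains three, two or one of the edges of the face. These are the tug at the
  -- opposite edge read backwards, a wiggle at the corner `i + 1` or `i`, and the tug at `i`.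
  by_cases g1 : faceEdge a p (i + 1) ∈ K <;> by_cases g3 : faceEdge a p (i + 3) ∈ K
  · refine ⟨i + 2, Or.inl ?_⟩
    rw [tug_act_eq, faceRegion_eq a p i (i + 2)]
    right
    rw [faceRegion_eq a p (i + 2) i, e21, e22, e23]
    apply meets
    · apply hreg <;> simp [*, d02.symm, d12.symm]
    · simp [Finset.insert_subset_iff, faceRegion]
    all_goals simp [verts_insert, verts_singleton, faceEdge_ends, e11, e31]
  · refine ⟨i + 1, Or.inr ?_⟩
    rw [wiggle_act_eq, faceRegion_eq a p i (i + 1)]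
    left
    rw [faceRegion_eq a p (i + 1) i, e13]
    apply meets
    · apply hreg <;> simp [*, d02.symm, d12.symm, d13.symm, d03.symm]
    · simp [Finset.insert_subset_iff, faceRegion]
    all_goals simp [verts_insert, verts_singleton, faceEdge_ends, e11]
    tauto
  · refine ⟨i, Or.inr ?_⟩
    rw [wiggle_act_eq]
    left
    apply meets
    · apply hreg <;> simp [*, d01.symm, d02.symm]
    · simp [Finset.insert_subset_iff, faceRegion]
    all_goals simp [verts_insert, verts_singleton, faceEdge_ends, e31]
    tauto
  · refine ⟨i, Or.inl ?_⟩
    rw [tug_act_eq]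
    left
    apply meets
    · apply hreg <;> simp [*, d01.symm, d02.symm, d03.symm]
    · simp [faceRegion]
    · simp [verts_singleton, faceEdge_ends]
    · exact fun h => absurd h (h1.resolve_left g1)
    · exact fun h => absurd h (h3.resolve_left g3)

/-! ### Graphs connected by moves in a box -/

/-- One move inside the box `[lo, hi]³`, described by numerators. -/
def Step (lo hi : ℤ) (K K' : Finset Edge) : Prop :=
  TwoValent K ∧
    ((∃ a p q, (∀ j, lo ≤ a j ∧ a j ≤ hi ∧ (j ≠ p → a j + 1 ≤ hi)) ∧
        (K' = (tugSwap a p q).act K ∨ K' = (wiggleSwap a p q).act K)) ∨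
      ∃ a p q, (∀ j, lo ≤ a j ∧ a j + 1 ≤ hi) ∧ K' = (wagSwap a p q).act K)

/-- A sequence of moves inside the box `[lo, hi]³`. -/
abbrev Reach (lo hi : ℤ) : Finset Edge → Finset Edge → Prop := Relation.ReflTransGen (Step lo hi)

theorem Step.twoValent {lo hi : ℤ} {K K' : Finset Edge} (h : Step lo hi K K') : TwoValent K' := by
  obtain ⟨hK, ⟨a, p, q, -, rfl | rfl⟩ | ⟨a, p, q, -, rfl⟩⟩ := h <;> exact hK.act _

/-- A move is its own inverse, but this is known only for graphs of valence two; hence the valence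
condition in `Step`. -/
theorem Step.symm {lo hi : ℤ} {K K' : Finset Edge} (h : Step lo hi K K') : Step lo hi K' K := by
  refine ⟨h.twoValent, ?_⟩
  obtain ⟨hK, ⟨a, p, q, hb, rfl | rfl⟩ | ⟨a, p, q, hb, rfl⟩⟩ := h
  · exact Or.inl ⟨a, p, q, hb, Or.inl (Swap.act_act _ hK).symm⟩
  · exact Or.inl ⟨a, p, q, hb, Or.inr (Swap.act_act _ hK).symm⟩
  · exact Or.inr ⟨a, p, q, hb, (Swap.act_act _ hK).symm⟩

theorem Step.mono {lo hi lo' hi' : ℤ} (hlo : lo' ≤ lo) (hhi : hi ≤ hi') {K K' : Finset Edge}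
    (h : Step lo hi K K') : Step lo' hi' K K' := by
  obtain ⟨hK, ⟨a, p, q, hb, h⟩ | ⟨a, p, q, hb, h⟩⟩ := h
  · refine ⟨hK, Or.inl ⟨a, p, q, fun j => ?_, h⟩⟩
    obtain ⟨h1, h2, h3⟩ := hb j
    exact ⟨by omega, by omega, fun hj => by have := h3 hj; omega⟩
  · refine ⟨hK, Or.inr ⟨a, p, q, fun j => ?_, h⟩⟩
    obtain ⟨h1, h2⟩ := hb j
    exact ⟨by omega, by omega⟩

theorem Reach.symm {lo hi : ℤ} {K K' : Finset Edge} (h : Reach lo hi K K') : Reach lo hi K' K :=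
  by
  induction h with
  | refl => exact .refl
  | tail _ h ih => exact .head h.symm ih

theorem Reach.mono {lo hi lo' hi' : ℤ} (hlo : lo' ≤ lo) (hhi : hi ≤ hi') {K K' : Finset Edge}
    (h : Reach lo hi K K') : Reach lo' hi' K K' :=
  by
  induction h with
  | refl => exact .refl
  | tail _ h ih => exact .tail ih (h.mono hlo hhi)

theorem Reach.twoValent {lo hi : ℤ} {K K' : Finset Edge} (h : Reach lo hi K K')
    (hK : TwoValent K) : TwoValent K' := by
  induction h with
  | refl => exact hK
  | tail _ h _ => exact h.twoValent

/-! ### Sweeping a layer into the next one -/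

theorem step_self (p : Fin 3) : step p p = 1 := by simp [step]

theorem step_of_ne {p j : Fin 3} (h : j ≠ p) : step p j = 0 := by simp [step, h]

theorem TwoValent.eq_or_eq {K : Finset Edge} (hK : TwoValent K) {v : Point} {e f g : Edge}
    (he : e ∈ K) (hf : f ∈ K) (hg : g ∈ K) (hve : v ∈ ends e) (hvf : v ∈ ends f)
    (hvg : v ∈ ends g) (hef : e ≠ f) : g = e ∨ g = f := by
  by_contra hne
  rw [not_or] at hne
  have h2 := hK v (mem_verts.2 ⟨e, he, hve⟩)
  have hsub : ({g, e, f} : Finset Edge) ⊆ K.filter (fun e => v ∈ ends e) := by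
    simp [Finset.insert_subset_iff, *]
  have := Finset.card_le_card hsub
  rw [Finset.card_eq_three.2 ⟨g, e, f, hne.1, hne.2, hef, rfl⟩] at this
  unfold degree at h2
  omega

theorem TwoValent.mem_of_forall {K : Finset Edge} (hK : TwoValent K) {v : Point} {e f : Edge}
    (he : e ∈ K) (hve : v ∈ ends e) (h : ∀ g ∈ K, v ∈ ends g → g = e ∨ g = f) : f ∈ K := by
  by_contra hf
  have h2 := hK v (mem_verts.2 ⟨e, he, hve⟩)
  have hsub : K.filter (fun e => v ∈ ends e) ⊆ {e} := by
    intro g hg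
    rw [Finset.mem_filter] at hg
    rcases h g hg.1 hg.2 with rfl | rfl
    · exact Finset.mem_singleton_self _
    · exact absurd hg.1 hf
  have := Finset.card_le_card hsub
  rw [Finset.card_singleton] at this
  unfold degree at h2
  omega

/-- The boundary of the face spanned at `u` by the directions `p` and `q`. -/
def square (u : Point) (p q : Fin 3) : Finset Edge :=
  {(u, q), (u + step q, p), (u + step p, q), (u, p)}

/-- Faces are indexed by their normal direction with a cyclic convention, while a sweep is described
by its direction `p` and by the pushed edge. The two cyclic orders of `p` and `q` make the pushed
edge number `0` or number `3` of the face. -/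
theorem exists_step_square {lo hi : ℤ} {K : Finset Edge} (hK : TwoValent K) {u : Point}
    {p q : Fin 3} (hpq : q ≠ p)
    (hb : ∀ j, lo ≤ u j ∧ u j ≤ hi ∧ (j = p ∨ j = q → u j + 1 ≤ hi))
    (h0 : (u, q) ∈ K) (h2 : (u + step p, q) ∉ K)
    (hu : (u, p) ∈ K ∨ u + step p ∉ verts K)
    (hv : (u + step q, p) ∈ K ∨ u + step q + step p ∉ verts K) :
    Step lo hi K (symmDiff K (square u p q)) := by
  have hr : ∀ p q : Fin 3, q ≠ p →
      ∃ r, r ≠ p ∧ r ≠ q ∧ ((q = r + 1 ∧ p = r + 2) ∨ (p = r + 1 ∧ q = r + 2)) := by decide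
  obtain ⟨r, hrp, hrq, h⟩ := hr p q hpq
  have hthird : ∀ p q r j : Fin 3, q ≠ p → r ≠ p → r ≠ q → j ≠ r → j = p ∨ j = q := by decide
  refine ⟨hK, Or.inl ⟨u, r, ?_⟩⟩
  have hb' : ∀ j, lo ≤ u j ∧ u j ≤ hi ∧ (j ≠ r → u j + 1 ≤ hi) := fun j =>
    ⟨(hb j).1, (hb j).2.1, fun hj => (hb j).2.2 (hthird p q r j hpq hrp hrq hj)⟩
  rcases h with ⟨rfl, rfl⟩ | ⟨rfl, rfl⟩
  · have hsq : square u (r + 2) (r + 1) = faceRegion u r 0 := by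
      simp [square, faceRegion, faceEdge]
    obtain ⟨i, hi⟩ := exists_act_eq_symmDiff (K := K) (a := u) (p := r) (i := 0)
      (by simpa [faceEdge] using h0) (by simpa [faceEdge] using h2)
      (by simpa [faceEdge, corner] using hv) (by simpa [faceEdge, corner] using hu)
    exact ⟨i, hb', by rw [hsq]; exact hi⟩
  · have hsq : square u (r + 1) (r + 2) = faceRegion u r 3 := by
      ext e
      simp [square, faceRegion, faceEdge]
      tauto
    obtain ⟨i, hi⟩ := exists_act_eq_symmDiff (K := K) (a := u) (p := r) (i := 3)
      (by simpa [faceEdge] using h0) (by simpa [faceEdge] using h2)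
      (by simpa [faceEdge, corner] using hu)
      (by simpa [faceEdge, corner, add_right_comm] using hv)
    exact ⟨i, hb', by rw [hsq]; exact hi⟩

/-- The layers `c` and `c + 1` in direction `p` can be merged: along each vertical edge between
them the graph either runs through this edge or meets at most one of its end points. -/
def Mergeable (p : Fin 3) (c : ℤ) (K : Finset Edge) : Prop :=
  (∀ v : Point, v p = c → (v, p) ∈ K ∨ v ∉ verts K ∨ v + step p ∉ verts K) ∧
    ∀ (u : Point) (q : Fin 3), q ≠ p → u p = c → (u, q) ∈ K → (u + step p, q) ∉ K

theorem mem_symmDiff_square {K : Finset Edge} {u : Point} {p q : Fin 3} {e : Edge} :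
    e ∈ symmDiff K (square u p q) ↔
      (e ∈ K ∧ e ∉ square u p q) ∨ (e ∈ square u p q ∧ e ∉ K) := by
  rw [Finset.mem_symmDiff]

theorem mem_square {u : Point} {p q : Fin 3} {e : Edge} :
    e ∈ square u p q ↔ e = (u, q) ∨ e = (u + step q, p) ∨ e = (u + step p, q) ∨ e = (u, p) := by
  simp [square]

/-- The only two edges of the graph at `w` are the pushed edge and the edge in direction `p`. Both
belong to the square, so both disappear, and the square has no other edge at `w`. -/
theorem not_mem_verts_symmDiff {K : Finset Edge} (hK : TwoValent K) {u w : Point} {p q : Fin 3}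
    (hpq : q ≠ p) (hw : w = u ∨ w = u + step q) (h0 : (u, q) ∈ K) (hwp : (w, p) ∈ K) :
    w ∉ verts (symmDiff K (square u p q)) := by
  intro hv
  obtain ⟨f, hf, hwf⟩ := mem_verts.1 hv
  have hwe : w ∈ ends (u, q) := mem_ends.2 hw
  have hne : ((u, q) : Edge) ≠ (w, p) := fun h => hpq (congrArg Prod.snd h)
  have hwsq : (w, p) ∈ square u p q := by
    rw [mem_square]
    rcases hw with rfl | rfl <;> simp
  have hwp' : w p = u p := by
    rcases hw with rfl | rfl
    · rfl
    · simp [step_of_ne hpq.symm]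
  rw [mem_symmDiff_square] at hf
  rcases hf with ⟨hfK, hfs⟩ | ⟨hfs, hfK⟩
  · rcases hK.eq_or_eq h0 hwp hfK hwe (mem_ends.2 (Or.inl rfl)) hwf hne with rfl | rfl
    · exact hfs (mem_square.2 (Or.inl rfl))
    · exact hfs hwsq
  · have key : ∀ x : Point, x p = u p → w ∈ ends (x, p) → x = w := by
      intro x hx h
      rcases mem_ends.1 h with h | h
      · exact h.symm
      · have := congrFun h p
        rw [Pi.add_apply, step_self] at this
        omega
    rcases mem_square.1 hfs with rfl | rfl | rfl | rfl
    · exact hfK h0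
    · rw [key _ (by simp [step_of_ne hpq.symm]) hwf] at hfK
      exact hfK hwp
    · rcases mem_ends.1 hwf with h | h
      · have := congrFun h p
        rw [Pi.add_apply, step_self] at this
        omega
      · have := congrFun h p
        rw [Pi.add_apply, Pi.add_apply, step_self, step_of_ne hpq.symm] at this
        omega
    · rw [key _ rfl hwf] at hfK
      exact hfK hwp

/-- The invariant that allows the edges of a layer to be pushed one after another, in any order. -/
theorem Mergeable.symmDiff_square {K : Finset Edge} {p q : Fin 3} {c : ℤ}
    (hM : Mergeable p c K) (hK : TwoValent K) {u : Point}
    (hpq : q ≠ p) (huc : u p = c) (h0 : (u, q) ∈ K) :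
    Mergeable p c (symmDiff K (square u p q)) := by
  have hqp := step_of_ne hpq.symm
  constructor
  · intro v hvc
    -- At an end of the pushed edge, the connecting edge to the next layer is either deleted, and
    -- then the lower vertex becomes free, or created. All other columns do not touch the square.
    by_cases hv : v = u ∨ v = u + step q
    · have hsq : (v, p) ∈ square u p q := by
        rw [mem_square]
        rcases hv with rfl | rfl <;> simp
      by_cases hvp : (v, p) ∈ K
      · exact Or.inr (Or.inl (not_mem_verts_symmDiff hK hpq hv h0 hvp))
      · exact Or.inl (mem_symmDiff_square.2 (Or.inr ⟨hsq, hvp⟩))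
    · rw [not_or] at hv
      have hsq : ∀ f ∈ square u p q, ∀ w, (w = v ∨ w = v + step p) → w ∉ ends f := by
        intro f hf w hw hwf
        have hends : w = u ∨ w = u + step q ∨ w = u + step p ∨ w = u + step q + step p := by
          rcases mem_square.1 hf with rfl | rfl | rfl | rfl <;> rw [mem_ends] at hwf
          · tauto
          · tauto
          · rw [add_right_comm] at hwf; tauto
          · tauto
        rcases hw with rfl | rfl
        · rcases hends with h | h | h | h
          · exact hv.1 h
          · exact hv.2 h
          · have := congrFun h p
            simp only [Pi.add_apply, step_self] at this
            omega
          · have := congrFun h p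
            simp only [Pi.add_apply, step_self, hqp] at this
            omega
        · rcases hends with h | h | h | h
          · have := congrFun h p
            simp only [Pi.add_apply, step_self] at this
            omega
          · have := congrFun h p
            simp only [Pi.add_apply, step_self, hqp] at this
            omega
          · exact hv.1 (add_right_cancel h)
          · exact hv.2 (add_right_cancel h)
      have hverts : ∀ w, (w = v ∨ w = v + step p) →
          w ∈ verts (symmDiff K (square u p q)) → w ∈ verts K := by
        intro w hw h
        obtain ⟨f, hf, hwf⟩ := mem_verts.1 h
        rcases mem_symmDiff_square.1 hf with ⟨h1, -⟩ | ⟨h1, -⟩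
        · exact mem_verts.2 ⟨f, h1, hwf⟩
        · exact absurd hwf (hsq f h1 w hw)
      rcases hM.1 v hvc with h | h | h
      · exact Or.inl (mem_symmDiff_square.2 (Or.inl ⟨h, fun hs =>
          hsq _ hs v (Or.inl rfl) (mem_ends.2 (Or.inl rfl))⟩))
      · exact Or.inr (Or.inl fun h' => h (hverts v (Or.inl rfl) h'))
      · exact Or.inr (Or.inr fun h' => h (hverts _ (Or.inr rfl) h'))
  · intro x s hsp hxc hx hx'
    have hx2 : (x, s) ∈ K ∧ (x, s) ≠ (u, q) := by
      rcases mem_symmDiff_square.1 hx with ⟨h1, h2⟩ | ⟨h1, h2⟩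
      · exact ⟨h1, fun h => h2 (mem_square.2 (Or.inl h))⟩
      · exfalso
        rcases mem_square.1 h1 with h | h | h | h <;> rw [Prod.mk.injEq] at h
        · exact h2 (by rw [h.1, h.2]; exact h0)
        · exact hsp h.2
        · have := congrFun h.1 p
          simp only [Pi.add_apply, step_self] at this
          omega
        · exact hsp h.2
    have hx3 := hM.2 x s hsp hxc hx2.1
    rcases mem_symmDiff_square.1 hx' with ⟨h1, -⟩ | ⟨h1, -⟩
    · exact hx3 h1
    · rcases mem_square.1 h1 with h | h | h | h <;> rw [Prod.mk.injEq] at h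
      · have := congrFun h.1 p
        simp only [Pi.add_apply, step_self] at this
        omega
      · exact hsp h.2
      · exact hx2.2 (by rw [add_right_cancel h.1, h.2])
      · exact hsp h.2

/-- If the layers `c` and `c + 1` can be merged, then all edges inside the layer `c` can be moved
to the layer `c + 1`, changing nothing but these two layers and the edges between them. -/
theorem Mergeable.exists_reach {lo hi : ℤ} {p : Fin 3} {c : ℤ} {K : Finset Edge}
    (hM : Mergeable p c K) (hK : TwoValent K)
    (hb : ∀ (u : Point) (q : Fin 3), q ≠ p → u p = c → (u, q) ∈ K →
      ∀ j, lo ≤ u j ∧ u j ≤ hi ∧ (j = p ∨ j = q → u j + 1 ≤ hi)) :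
    ∃ K', Reach lo hi K K' ∧
      (∀ (x : Point) (q : Fin 3), x p ≠ c → (q = p ∨ x p ≠ c + 1) →
        ((x, q) ∈ K' ↔ (x, q) ∈ K)) ∧
      ∀ (x : Point) (q : Fin 3), q ≠ p → x p = c →
        (x, q) ∉ K' ∧ ((x + step p, q) ∈ K' ↔ (x, q) ∈ K ∨ (x + step p, q) ∈ K) := by
  -- Each push lowers the number of edges inside the layer `c` by one.
  induction hn : (K.filter fun e => e.1 p = c ∧ e.2 ≠ p).card generalizing K with
  | zero =>
    rw [Finset.card_eq_zero, Finset.filter_eq_empty_iff] at hn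
    refine ⟨K, .refl, fun _ _ _ _ => Iff.rfl, fun x q hq hx => ?_⟩
    have : (x, q) ∉ K := fun h => hn h ⟨hx, hq⟩
    exact ⟨this, by simp [this]⟩
  | succ n ih =>
    obtain ⟨⟨u, q⟩, hu⟩ : (K.filter fun e => e.1 p = c ∧ e.2 ≠ p).Nonempty := by
      rw [← Finset.card_pos]; omega
    obtain ⟨h0, huc, hpq⟩ := Finset.mem_filter.1 hu
    simp only at huc hpq
    have hqp := step_of_ne hpq.symm
    -- For a vertex on the graph the middle alternative of `Mergeable` is excluded; what remains is
    -- the corner condition for a tug or wiggle.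
    have hcol : ∀ v, v p = c → v ∈ verts K → (v, p) ∈ K ∨ v + step p ∉ verts K := by
      intro v hv hvK
      have := hM.1 v hv
      tauto
    have hstep : Step lo hi K (symmDiff K (square u p q)) := by
      refine exists_step_square hK hpq (hb u q hpq huc h0) h0 (hM.2 u q hpq huc h0)
        (hcol u huc (mem_verts.2 ⟨_, h0, mem_ends.2 (Or.inl rfl)⟩))
        (hcol _ ?_ (mem_verts.2 ⟨_, h0, mem_ends.2 (Or.inr rfl)⟩))
      rw [Pi.add_apply, hqp, huc, add_zero]
    have hlow : ∀ (x : Point) (s : Fin 3), s ≠ p → x p = c →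
        ((x, s) ∈ symmDiff K (square u p q) ↔ (x, s) ∈ K ∧ (x, s) ≠ (u, q)) := by
      intro x s hsp hxc
      have : (x, s) ∈ square u p q ↔ (x, s) = (u, q) := by
        rw [mem_square]
        refine ⟨?_, Or.inl⟩
        rintro (h | h | h | h)
        · exact h
        · exact absurd (congrArg Prod.snd h) hsp
        · have := congrFun (congrArg Prod.fst h) p
          simp only [Pi.add_apply, step_self] at this
          omega
        · exact absurd (congrArg Prod.snd h) hsp
      rw [mem_symmDiff_square, this]
      constructor
      · rintro (h | ⟨h, h'⟩)
        · exact h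
        · rw [h] at h'
          exact absurd h0 h'
      · exact Or.inl
    have hhigh : ∀ (x : Point) (s : Fin 3), s ≠ p → x p = c →
        ((x + step p, s) ∈ symmDiff K (square u p q) ↔
          (x + step p, s) ∈ K ∨ (x, s) = (u, q)) := by
      intro x s hsp hxc
      have : (x + step p, s) ∈ square u p q ↔ (x, s) = (u, q) := by
        rw [mem_square]
        constructor
        · rintro (h | h | h | h)
          · have := congrFun (congrArg Prod.fst h) p
            simp only [Pi.add_apply, step_self] at this
            omega
          · exact absurd (congrArg Prod.snd h) hsp
          · rw [Prod.mk.injEq] at h ⊢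
            exact ⟨add_right_cancel h.1, h.2⟩
          · exact absurd (congrArg Prod.snd h) hsp
        · intro h
          rw [Prod.mk.injEq] at h
          rw [h.1, h.2]
          exact Or.inr (Or.inr (Or.inl rfl))
      rw [mem_symmDiff_square, this]
      constructor
      · rintro (⟨h, -⟩ | ⟨h, -⟩)
        exacts [Or.inl h, Or.inr h]
      · rintro (h | h)
        · by_cases h' : (x, s) = (u, q)
          · rw [Prod.mk.injEq] at h'
            rw [h'.1, h'.2] at h
            exact absurd h (hM.2 u q hpq huc h0)
          · exact Or.inl ⟨h, h'⟩
        · refine Or.inr ⟨h, ?_⟩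
          rw [Prod.mk.injEq] at h
          rw [h.1, h.2]
          exact hM.2 u q hpq huc h0
    obtain ⟨K', hreach, hout, hin⟩ := ih (hM.symmDiff_square hK hpq huc h0) hstep.twoValent
      (fun x s hsp hxc hx => hb x s hsp hxc ((hlow x s hsp hxc).1 hx).1) (by
        have : (symmDiff K (square u p q)).filter (fun e => e.1 p = c ∧ e.2 ≠ p) =
            (K.filter fun e => e.1 p = c ∧ e.2 ≠ p).erase (u, q) := by
          ext ⟨x, s⟩
          simp only [Finset.mem_filter, Finset.mem_erase]
          constructor
          · rintro ⟨h1, h2, h3⟩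
            have := (hlow x s h3 h2).1 h1
            exact ⟨this.2, this.1, h2, h3⟩
          · rintro ⟨h1, h2, h3, h4⟩
            exact ⟨(hlow x s h4 h3).2 ⟨h2, h1⟩, h3, h4⟩
        rw [this, Finset.card_erase_of_mem hu, hn]
        rfl)
    refine ⟨K', .head hstep hreach, fun x s hxc hs => ?_, fun x s hsp hxc => ?_⟩
    · rw [hout x s hxc hs]
      have : (x, s) ∉ square u p q := by
        intro h
        rcases mem_square.1 h with h | h | h | h <;> rw [Prod.mk.injEq] at h <;>
          have h1 := congrFun h.1 p <;> obtain ⟨-, rfl⟩ := h <;>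
          try simp only [Pi.add_apply, step_self, hqp] at h1
        · omega
        · omega
        · exact hs.elim hpq (fun h => h (by omega))
        · omega
      rw [mem_symmDiff_square]
      tauto
    · obtain ⟨h1, h2⟩ := hin x s hsp hxc
      refine ⟨h1, ?_⟩
      rw [h2, hlow x s hsp hxc, hhigh x s hsp hxc]
      by_cases h : (x, s) = (u, q)
      · have : (x, s) ∈ K := by rw [h]; exact h0
        tauto
      · tauto

/-! ### Inserting an empty layer -/

/-- The lattice graph obtained by inserting an empty layer after the layer `c` perpendicular to the
direction `p`: everything beyond the layer `c` is moved by one step, and the edges leaving the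
layer `c` are replaced by two edges each. -/
def stretch (p : Fin 3) (c : ℤ) (K : Finset Edge) : Finset Edge :=
  (K.filter fun e => e.1 p ≤ c) ∪
    (K.filter fun e => c < e.1 p ∨ (e.1 p = c ∧ e.2 = p)).image (shift (step p))

theorem mem_image_shift {a x : Point} {q : Fin 3} {K : Finset Edge} :
    (x, q) ∈ K.image (shift a) ↔ (x - a, q) ∈ K := by
  rw [Finset.mem_image]
  constructor
  · rintro ⟨⟨y, r⟩, h, h'⟩
    simp only [shift, Prod.mk.injEq] at h'
    obtain ⟨rfl, rfl⟩ := h'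
    rwa [add_sub_cancel_left]
  · intro h
    exact ⟨_, h, by simp [shift]⟩

theorem mem_stretch {p : Fin 3} {c : ℤ} {K : Finset Edge} {x : Point} {q : Fin 3} :
    (x, q) ∈ stretch p c K ↔ ((x, q) ∈ K ∧ x p ≤ c) ∨
      ((x - step p, q) ∈ K ∧ (c + 1 < x p ∨ (x p = c + 1 ∧ q = p))) := by
  rw [stretch, Finset.mem_union, mem_image_shift, Finset.mem_filter, Finset.mem_filter]
  simp only [Pi.sub_apply, step_self, lt_sub_iff_add_lt, sub_eq_iff_eq_add]

/-- All edges of the lattice graph lie in the box with the given corner opposite to the origin. -/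
def BoundedBy (b : Fin 3 → ℤ) (K : Finset Edge) : Prop :=
  ∀ x q, (x, q) ∈ K → ∀ j, 0 ≤ x j ∧ x j ≤ b j ∧ (j = q → x j + 1 ≤ b j)

/-- The inserted layer only contains midpoints of edges that were replaced by two, so a vertex there
always comes with the edge below it. -/
theorem mergeable_stretch (p : Fin 3) (c : ℤ) (K : Finset Edge) :
    Mergeable p c (stretch p c K) := by
  constructor
  · intro v hv
    by_contra! h
    obtain ⟨hvp, -, h⟩ := h
    obtain ⟨⟨y, q⟩, hy, hvy⟩ := mem_verts.1 h
    have hp : ∀ {w : Point}, v + step p = w → w p = c + 1 := by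
      rintro _ rfl
      rw [Pi.add_apply, step_self, hv]
    have hy' := mem_stretch.1 hy
    rcases mem_ends.1 hvy with h1 | h1
    · have h2 := hp h1
      have hq : q = p := by
        by_contra hq
        rcases hy' with ⟨-, h3⟩ | ⟨-, h3 | ⟨-, h3⟩⟩
        exacts [by omega, by omega, hq h3]
      subst hq
      refine hvp (mem_stretch.2 (Or.inl ⟨?_, hv.le⟩))
      rcases hy' with ⟨-, h3⟩ | ⟨h3, -⟩
      · omega
      · rwa [← h1, add_sub_cancel_right] at h3
    · by_cases hq : q = p
      · subst hq
        rw [add_right_cancel h1] at hvp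
        exact hvp hy
      · have h2 := hp h1
        rw [Pi.add_apply, step_of_ne (Ne.symm hq), add_zero] at h2
        rcases hy' with ⟨-, h3⟩ | ⟨-, h3 | ⟨-, h3⟩⟩
        exacts [by omega, by omega, hq h3]
  · intro u q hq hu _ h
    rw [mem_stretch, Pi.add_apply, step_self] at h
    rcases h with ⟨-, h3⟩ | ⟨-, h3 | ⟨-, h3⟩⟩
    exacts [by omega, by omega, hq h3]

/-- Sweeping the layer `c` into the empty layer `c + 1` makes `c` the empty layer. The side
condition `b p + 1 ≤ N` leaves room for the additional layer. -/
theorem reach_stretch_succ {N : ℤ} {b : Fin 3 → ℤ} {p : Fin 3} {c : ℤ} {K : Finset Edge}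
    (hK : TwoValent (stretch p c K)) (hb : BoundedBy b K) (hbN : ∀ j, b j ≤ N)
    (hp : b p + 1 ≤ N) : Reach 0 N (stretch p c K) (stretch p (c - 1) K) := by
  obtain ⟨K', hreach, hout, hin⟩ := (mergeable_stretch p c K).exists_reach (lo := 0) (hi := N) hK
    (by
      intro u q hq hu hmem j
      have hmem' : (u, q) ∈ K := by
        rcases mem_stretch.1 hmem with h | ⟨-, h⟩
        · exact h.1
        · omega
      obtain ⟨h1, h2, h3⟩ := hb u q hmem' j
      have h4 := hbN j
      refine ⟨h1, by omega, ?_⟩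
      rintro (rfl | rfl)
      · omega
      · have := h3 rfl
        omega)
  have hK' := hreach.twoValent hK
  suffices h : K' = stretch p (c - 1) K by rwa [← h]
  ext ⟨x, q⟩
  have hsub : (x - step p) p = x p - 1 := by rw [Pi.sub_apply, step_self]
  by_cases hq : q = p
  · subst hq
    by_cases hx : x q = c
    · have hdown : (x - step q, q) ∈ K' ↔ (x - step q, q) ∈ K := by
        rw [hout _ _ (by omega) (Or.inl rfl), mem_stretch]
        constructor
        · rintro (h | h)
          · exact h.1
          · omega
        · intro h
          exact Or.inl ⟨h, by omega⟩
      have hedges : ∀ g ∈ K', x ∈ ends g → g = (x, q) ∨ g = (x - step q, q) := by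
        rintro ⟨y, r⟩ hg hxg
        have hr : r = q := by
          by_contra hr
          refine (hin y r hr ?_).1 hg
          rcases mem_ends.1 hxg with h | h
          · rw [← h, hx]
          · rw [h, Pi.add_apply, step_of_ne (Ne.symm hr), add_zero] at hx
            exact hx
        subst hr
        rcases mem_ends.1 hxg with h | h
        · exact Or.inl (by rw [h])
        · exact Or.inr (by rw [h, add_sub_cancel_right])
      have hxd : x ∈ ends (x - step q, q) := mem_ends.2 (Or.inr (by rw [sub_add_cancel]))
      -- The sweep lemma says nothing about the edges between the layers `c` and `c + 1`. They are
      -- determined by valence: no edge inside the layer `c` is left, so the edges above and below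
      -- `x` are both present or both absent.
      have hiff : (x, q) ∈ K' ↔ (x - step q, q) ∈ K' :=
        ⟨fun h => hK'.mem_of_forall h (mem_ends.2 (Or.inl rfl)) hedges,
          fun h => hK'.mem_of_forall h hxd fun g hg hxg => (hedges g hg hxg).symm⟩
      rw [hiff, hdown, mem_stretch]
      constructor
      · exact fun h => Or.inr ⟨h, Or.inr ⟨by omega, rfl⟩⟩
      · rintro (h | h)
        · omega
        · exact h.1
    · rw [hout _ _ hx (Or.inl rfl), mem_stretch, mem_stretch]
      have e1 : x q ≤ c ↔ x q ≤ c - 1 := by omega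
      have e2 : (c + 1 < x q ∨ (x q = c + 1 ∧ q = q)) ↔
          (c - 1 + 1 < x q ∨ (x q = c - 1 + 1 ∧ q = q)) := by omega
      rw [e1, e2]
  · by_cases hx : x p = c
    · refine iff_of_false (hin x q hq hx).1 fun h => ?_
      rw [mem_stretch] at h
      rcases h with ⟨-, h3⟩ | ⟨-, h3 | ⟨-, h3⟩⟩
      exacts [by omega, by omega, hq h3]
    -- The target layer had no edges of its own, so after the sweep it contains exactly those that
    -- came from the layer `c`.
    · by_cases hx' : x p = c + 1
      · have h1 := (hin (x - step p) q hq (by omega)).2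
        rw [sub_add_cancel] at h1
        rw [h1, mem_stretch, mem_stretch, mem_stretch]
        simp only [hq, and_false, or_false, hsub]
        have e1 : x p - 1 ≤ c := by omega
        have e2 : ¬ c + 1 < x p - 1 := by omega
        have e3 : ¬ x p ≤ c := by omega
        have e4 : ¬ c + 1 < x p := by omega
        have e5 : ¬ x p ≤ c - 1 := by omega
        have e6 : c - 1 + 1 < x p := by omega
        simp only [e1, e2, e3, e4, e5, e6, and_true, and_false, or_false, false_or]
      · rw [hout _ _ hx (Or.inr hx'), mem_stretch, mem_stretch]
        simp only [hq, and_false, or_false]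
        have e1 : x p ≤ c ↔ x p ≤ c - 1 := by omega
        have e2 : c + 1 < x p ↔ c - 1 + 1 < x p := by omega
        rw [e1, e2]

/-- Here the empty layer lies beyond the graph; this is where its journey starts. -/
theorem stretch_eq_self {b : Fin 3 → ℤ} {p : Fin 3} {K : Finset Edge} (hb : BoundedBy b K) :
    stretch p (b p) K = K := by
  ext ⟨x, q⟩
  rw [mem_stretch]
  constructor
  · rintro (h | ⟨h, h'⟩)
    · exact h.1
    · have h1 := hb _ _ h p
      rw [Pi.sub_apply, step_self] at h1
      rcases h' with h' | ⟨h', rfl⟩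
      · omega
      · have := h1.2.2 rfl
        omega
  · exact fun h => Or.inl ⟨h, (hb _ _ h p).2.1⟩

/-- A bounded lattice graph can be stretched by moves. -/
theorem reach_stretch {N : ℤ} {b : Fin 3 → ℤ} {p : Fin 3} {K : Finset Edge}
    (hK : TwoValent K) (hb : BoundedBy b K) (hbN : ∀ j, b j ≤ N) (hp : b p + 1 ≤ N) {c : ℤ}
    (hc : c ≤ b p) : Reach 0 N K (stretch p c K) := by
  induction c, hc using Int.leInductionDown with
  | base => rw [stretch_eq_self hb]
  | pred c hc ih => exact ih.trans (reach_stretch_succ (ih.twoValent hK) hb hbN hp)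

theorem stretch_neg_one {b : Fin 3 → ℤ} {p : Fin 3} {K : Finset Edge} (hb : BoundedBy b K) :
    stretch p (-1) K = K.image (shift (step p)) := by
  ext ⟨x, q⟩
  rw [mem_stretch, mem_image_shift]
  constructor
  · rintro (⟨h, h'⟩ | h)
    · have := hb _ _ h p
      omega
    · exact h.1
  · intro h
    have := hb _ _ h p
    rw [Pi.sub_apply, step_self] at this
    exact Or.inr ⟨h, Or.inl (by omega)⟩

theorem BoundedBy.image_shift {b : Fin 3 → ℤ} {K : Finset Edge} (hb : BoundedBy b K) {a : Point}
    (ha : ∀ j, 0 ≤ a j) : BoundedBy (b + a) (K.image (shift a)) := by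
  intro x q hx j
  obtain ⟨h1, h2, h3⟩ := hb _ _ (mem_image_shift.1 hx) j
  simp only [Pi.sub_apply, Pi.add_apply] at *
  have := ha j
  exact ⟨by omega, by omega, fun h => by have := h3 h; omega⟩

theorem image_shift_image_shift (a a' : Point) (K : Finset Edge) :
    (K.image (shift a)).image (shift a') = K.image (shift (a + a')) := by
  ext ⟨x, q⟩
  rw [mem_image_shift, mem_image_shift, mem_image_shift, sub_sub, add_comm a]

theorem image_shift_zero (K : Finset Edge) : K.image (shift 0) = K := by
  ext ⟨x, q⟩
  rw [mem_image_shift, sub_zero]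

theorem reach_image_shift_step {N : ℤ} {b : Fin 3 → ℤ} {K : Finset Edge}
    (hK : TwoValent K) (hb : BoundedBy b K) (hb0 : ∀ j, 0 ≤ b j) (p : Fin 3) (k : ℕ)
    (hN : ∀ j, b j + k • step p j ≤ N) :
    Reach 0 N K (K.image (shift (k • step p))) := by
  induction k with
  | zero => rw [zero_smul, image_shift_zero]
  | succ k ih =>
    have h0 : ∀ j, 0 ≤ step p j := fun j => by
      by_cases h : j = p
      · rw [h, step_self]; omega
      · rw [step_of_ne h]
    have h1 : ∀ j, 0 ≤ (k • step p) j := fun j => nsmul_nonneg (h0 j) k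
    have h2 : Reach 0 N K (K.image (shift (k • step p))) := ih fun j => by
      have h3 := hN j
      rw [succ_nsmul] at h3
      have := h0 j
      omega
    have hb1 := hb.image_shift h1
    refine h2.trans ?_
    -- One further unit of translation is the insertion of an empty layer below the whole graph.
    rw [succ_nsmul, ← image_shift_image_shift, ← stretch_neg_one hb1]
    refine reach_stretch (h2.twoValent hK) hb1 (fun j => ?_) ?_ ?_
    · have h3 := hN j
      rw [succ_nsmul] at h3
      have := h0 j
      rw [Pi.add_apply, Pi.smul_apply]
      omega
    · have h3 := hN p
      rw [succ_nsmul, step_self] at h3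
      rw [Pi.add_apply, Pi.smul_apply, step_self]
      omega
    · have := hb0 p
      have := h1 p
      rw [Pi.add_apply]
      omega

/-- A lattice graph in the positive octant can be translated along the main diagonal. -/
theorem reach_image_shift_diagonal {N B : ℤ} {K : Finset Edge} (hK : TwoValent K)
    (hB : 0 ≤ B) (hb : BoundedBy (fun _ => B) K) (k : ℕ) (hN : B + k ≤ N) :
    Reach 0 N K (K.image (shift fun _ => (k : ℤ))) := by
  have hs : ∀ p j : Fin 3, (k • step p) j = if j = p then (k : ℤ) else 0 := by
    intro p j
    by_cases h : j = p <;> simp [h, step]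
  have hs' : ∀ p j : Fin 3, k • step p j = if j = p then (k : ℤ) else 0 := hs
  have h0 : ∀ p j, 0 ≤ (k • step p) j := by
    intro p j
    rw [hs]
    split_ifs <;> omega
  have hsum : (fun _ => (k : ℤ) : Point) = k • step 0 + k • step 1 + k • step 2 := by
    funext j
    rw [Pi.add_apply, Pi.add_apply, hs, hs, hs]
    fin_cases j <;> simp
  have r0 : Reach 0 N K (K.image (shift (k • step 0))) :=
    reach_image_shift_step hK hb (fun _ => hB) 0 k fun j => by
      rw [hs']
      split_ifs <;> omega
  have b0 := hb.image_shift (h0 0)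
  have r1 := reach_image_shift_step (N := N) (r0.twoValent hK) b0
    (fun j => add_nonneg hB (h0 0 j)) 1 k fun j => by
      rw [hs', Pi.add_apply, hs]
      fin_cases j <;> simp <;> omega
  have b1 := b0.image_shift (h0 1)
  have r2 := reach_image_shift_step (N := N) (r1.twoValent (r0.twoValent hK)) b1
    (fun j => add_nonneg (add_nonneg hB (h0 0 j)) (h0 1 j)) 2 k fun j => by
      rw [hs', Pi.add_apply, Pi.add_apply, hs, hs]
      fin_cases j <;> simp <;> omega
  rw [hsum, ← image_shift_image_shift, ← image_shift_image_shift]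
  exact (r0.trans r1).trans r2

/-! ### Refinement as an iterated stretching -/

/-- `K'` is the image of `K` under the map of the cubic grid given by the three coordinate maps
`f j`, each image of an edge being subdivided into edges. -/
def StretchOf (f : Fin 3 → ℤ → ℤ) (K K' : Finset Edge) : Prop :=
  ∀ x q, (x, q) ∈ K' ↔
    ∃ y, (y, q) ∈ K ∧ (∀ j ≠ q, x j = f j (y j)) ∧ f q (y q) ≤ x q ∧ x q < f q (y q + 1)

theorem StretchOf.unique {f : Fin 3 → ℤ → ℤ} {K K' K'' : Finset Edge} (h : StretchOf f K K')
    (h' : StretchOf f K K'') : K' = K'' := by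
  ext ⟨x, q⟩
  rw [h, h']

/-- Only values on the box matter. This is needed because inserting layers realizes maps that agree
with doubling on the nonnegative coordinates only. -/
theorem StretchOf.congr {f g : Fin 3 → ℤ → ℤ} {b : Fin 3 → ℤ} {K K' : Finset Edge}
    (h : StretchOf f K K') (hb : BoundedBy b K)
    (hfg : ∀ j t, 0 ≤ t → t ≤ b j → f j t = g j t) : StretchOf g K K' := by
  intro x q
  rw [h x q]
  refine exists_congr fun y => and_congr_right fun hy => ?_
  have h1 := fun j => hfg j (y j) (hb y q hy j).1 (hb y q hy j).2.1
  have h2 := hfg q (y q + 1) (by have := hb y q hy q; omega) ((hb y q hy q).2.2 rfl)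
  simp only [h1, h2]

theorem StretchOf.boundedBy {f : Fin 3 → ℤ → ℤ} {b : Fin 3 → ℤ} {K K' : Finset Edge}
    (h : StretchOf f K K') (hb : BoundedBy b K) (hf : ∀ j, Monotone (f j))
    (h0 : ∀ j, 0 ≤ f j 0) : BoundedBy (fun j => f j (b j)) K' := by
  intro x q hx j
  obtain ⟨y, hy, h1, h2, h3⟩ := (h x q).1 hx
  obtain ⟨h4, h5, h6⟩ := hb y q hy j
  have h7 := hf j h4
  have h8 := h0 j
  change 0 ≤ x j ∧ x j ≤ f j (b j) ∧ (j = q → x j + 1 ≤ f j (b j))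
  by_cases hj : j = q
  · subst hj
    have h9 := hf j (h6 rfl)
    exact ⟨by omega, by omega, fun _ => by omega⟩
  · have h9 := hf j h5
    have h10 := h1 j hj
    exact ⟨by omega, by omega, fun h => absurd h hj⟩

/-- A discrete intermediate value theorem. It locates the edge of an intermediate graph over which a
given edge of the final graph lies. -/
theorem exists_between_of_le_of_lt (g : ℤ → ℤ) {a b m : ℤ} (hab : a ≤ b) (ha : g a ≤ m)
    (hb : m < g b) : ∃ z, a ≤ z ∧ z + 1 ≤ b ∧ g z ≤ m ∧ m < g (z + 1) := by
  induction b, hab using Int.leInduction with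
  | base => omega
  | succ b hab ih =>
    by_cases h : m < g b
    · obtain ⟨z, h1, h2, h3⟩ := ih h
      exact ⟨z, h1, by omega, h3⟩
    · exact ⟨b, hab, le_rfl, by omega, hb⟩

theorem StretchOf.comp {f g : Fin 3 → ℤ → ℤ} {K K' K'' : Finset Edge} (h : StretchOf f K K')
    (h' : StretchOf g K' K'') (hf : ∀ j, Monotone (f j)) (hg : ∀ j, Monotone (g j)) :
    StretchOf (fun j => g j ∘ f j) K K'' := by
  intro x q
  rw [h']
  constructor
  · rintro ⟨z, hz, h1, h2, h3⟩
    obtain ⟨y, hy, h4, h5, h6⟩ := (h z q).1 hz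
    refine ⟨y, hy, fun j hj => ?_, (hg q h5).trans h2, h3.trans_le (hg q h6)⟩
    rw [h1 j hj, h4 j hj]
    rfl
  · rintro ⟨y, hy, h1, h2, h3⟩
    obtain ⟨z, h4, h5, h6, h7⟩ := exists_between_of_le_of_lt (g q)
      (hf q (show y q ≤ y q + 1 by omega)) h2 h3
    refine ⟨fun j => if j = q then z else f j (y j), (h _ q).2 ⟨y, hy, fun j hj => ?_, ?_, ?_⟩,
      fun j hj => ?_, ?_, ?_⟩
    · simp [hj]
    · simpa using h4
    · simp only [if_true]; omega
    · simp [hj, h1 j hj]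
    · simpa using h6
    · simpa using h7

/-- The coordinate map which is the identity except in the direction `p`. -/
def along (p : Fin 3) (f : ℤ → ℤ) : Fin 3 → ℤ → ℤ := fun j => if j = p then f else id

theorem along_self (p : Fin 3) (f : ℤ → ℤ) : along p f p = f := if_pos rfl

theorem along_of_ne {p j : Fin 3} (h : j ≠ p) (f : ℤ → ℤ) : along p f j = id := if_neg h

theorem monotone_along {f : ℤ → ℤ} (hf : Monotone f) (p j : Fin 3) : Monotone (along p f j) := by
  unfold along
  split_ifs
  exacts [hf, monotone_id]

theorem stretchOf_stretch (p : Fin 3) (c : ℤ) (K : Finset Edge) :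
    StretchOf (along p fun t => if t ≤ c then t else t + 1) K (stretch p c K) := by
  intro x q
  rw [mem_stretch]
  have hsub : ∀ j, j ≠ p → (x - step p) j = x j := fun j hj => by
    rw [Pi.sub_apply, step_of_ne hj, sub_zero]
  have hsub' : (x - step p) p = x p - 1 := by rw [Pi.sub_apply, step_self]
  constructor
  · rintro (⟨h, h'⟩ | ⟨h, h'⟩)
    · refine ⟨x, h, fun j _ => ?_, ?_⟩
      · by_cases hj : j = p
        · subst hj; rw [along_self, if_pos h']
        · rw [along_of_ne hj, id]
      · by_cases hq : q = p
        · subst hq; rw [along_self]; split_ifs <;> omega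
        · rw [along_of_ne hq, id, id]; omega
    · refine ⟨_, h, fun j hjq => ?_, ?_⟩
      · by_cases hj : j = p
        · subst hj
          have := Ne.symm hjq
          rw [along_self, hsub']
          have : c + 1 < x j := by tauto
          split_ifs <;> omega
        · rw [along_of_ne hj, id, hsub j hj]
      · by_cases hq : q = p
        · subst hq; rw [along_self, hsub']; split_ifs <;> omega
        · rw [along_of_ne hq, id, id, hsub q hq]; omega
  · rintro ⟨y, hy, h1, h2, h3⟩
    have hne : ∀ j, j ≠ p → x j = y j := by
      intro j hj
      by_cases hjq : j = q
      · subst hjq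
        simp only [along_of_ne hj, id] at h2 h3
        omega
      · rw [h1 j hjq, along_of_ne hj, id]
    have hx : x p = y p → x = y := fun h => by
      funext j
      by_cases hj : j = p
      · rw [hj, h]
      · exact hne j hj
    have hx' : x p = y p + 1 → x - step p = y := fun h => by
      funext j
      by_cases hj : j = p
      · rw [hj, hsub']; omega
      · rw [hsub j hj, hne j hj]
    by_cases hq : q = p
    · subst hq
      rw [along_self] at h2 h3
      by_cases h4 : x q = y q
      · left
        rw [hx h4]
        refine ⟨hy, ?_⟩
        by_contra h5
        rw [if_neg h5] at h2
        omega
      · have h5 : x q = y q + 1 := by split_ifs at h2 h3 <;> omega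
        right
        rw [hx' h5]
        refine ⟨hy, ?_⟩
        split_ifs at h2 h3 <;> omega
    · have h4 := h1 p (Ne.symm hq)
      rw [along_self] at h4
      split_ifs at h4 with h5
      · left
        rw [hx h4]
        exact ⟨hy, h5⟩
      · right
        rw [hx' h4]
        exact ⟨hy, Or.inl (by omega)⟩

theorem stretchOf_id (K : Finset Edge) : StretchOf (fun _ => id) K K := by
  intro x q
  constructor
  · intro h
    exact ⟨x, h, fun _ _ => rfl, le_rfl, by simp⟩
  · rintro ⟨y, hy, h1, h2, h3⟩
    have : x = y := by
      funext j
      by_cases hj : j = q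
      · subst hj
        simp only [id] at h2 h3
        omega
      · exact h1 j hj
    rwa [this]

/-- Descending induction on `c`: the gaps between consecutive layers are doubled from the top down
to `c`, and `2 * b p - c` is the extent reached so far. -/
theorem reach_double_along {N : ℤ} {b : Fin 3 → ℤ} {K : Finset Edge} (hK : TwoValent K)
    (hb : BoundedBy b K) (hbN : ∀ j, b j ≤ N) (p : Fin 3) {c : ℤ} (hc : c ≤ b p) (hc0 : 0 ≤ c)
    (hN : 2 * b p - c ≤ N) :
    ∃ K', Reach 0 N K K' ∧ StretchOf (along p fun t => if t ≤ c then t else 2 * t - c) K K' := by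
  induction c, hc using Int.leInductionDown with
  | base =>
    refine ⟨K, .refl, (stretchOf_id K).congr hb fun j t _ ht => ?_⟩
    by_cases hj : j = p
    · subst hj; rw [along_self, if_pos ht, id]
    · rw [along_of_ne hj]
  | pred c hc ih =>
    obtain ⟨K', hr, hs⟩ := ih (by omega) (by omega)
    have hmono : Monotone fun t : ℤ => if t ≤ c then t else 2 * t - c := by
      intro s t hst
      simp only
      split_ifs <;> omega
    have hmono' : Monotone fun t : ℤ => if t ≤ c - 1 then t else t + 1 := by
      intro s t hst
      simp only
      split_ifs <;> omega
    have hb' := hs.boundedBy hb (monotone_along hmono p) (fun j => by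
      by_cases hj : j = p
      · subst hj; rw [along_self, if_pos (by omega)]
      · rw [along_of_ne hj, id])
    have hp : along p (fun t => if t ≤ c then t else 2 * t - c) p (b p) = 2 * b p - c := by
      rw [along_self]
      split_ifs <;> omega
    -- The layers up to `c` have not moved yet, so the next gap to be doubled still lies just above
    -- the layer `c - 1`.
    refine ⟨stretch p (c - 1) K', hr.trans (reach_stretch (hr.twoValent hK) hb' ?_ ?_ ?_), ?_⟩
    · intro j
      by_cases hj : j = p
      · subst hj; rw [hp]; omega
      · rw [along_of_ne hj]; exact hbN j
    · rw [hp]; omega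
    · rw [hp]; omega
    · convert hs.comp (stretchOf_stretch p (c - 1) K') (monotone_along hmono p)
        (monotone_along hmono' p) using 1
      funext j t
      by_cases hj : j = p
      · subst hj
        simp only [along_self, Function.comp_apply]
        split_ifs <;> omega
      · simp only [along_of_ne hj, Function.comp_apply, id]

theorem stretchOf_refineEdges (K : Finset Edge) :
    StretchOf (fun _ t => 2 * t) K (refineEdges K) := by
  intro x q
  rw [mem_refineEdges]
  refine exists_congr fun y => and_congr_right fun _ => ?_
  constructor
  · rintro (rfl | rfl)
    · refine ⟨fun j _ => by simp, ?_⟩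
      simp only [Pi.smul_apply, smul_eq_mul]
      omega
    · refine ⟨fun j hj => by simp [step_of_ne hj], ?_⟩
      simp only [Pi.add_apply, Pi.smul_apply, smul_eq_mul, step_self]
      omega
  · rintro ⟨h1, h2, h3⟩
    beta_reduce at h1 h2 h3
    by_cases h : x q = 2 * y q
    · left
      funext j
      by_cases hj : j = q
      · rw [hj, h]; rfl
      · exact h1 j hj
    · right
      funext j
      by_cases hj : j = q
      · subst hj
        simp only [Pi.add_apply, Pi.smul_apply, smul_eq_mul, step_self]
        omega
      · simp [step_of_ne hj, h1 j hj]

theorem monotone_double : Monotone fun t : ℤ => if t ≤ 0 then t else 2 * t - 0 := by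
  intro s t hst
  simp only
  split_ifs <;> omega

/-- A lattice graph in the positive octant and its refinement, read in the same lattice, are
connected by moves in the smallest cube that contains the latter. -/
theorem reach_refineEdges {B : ℤ} {K : Finset Edge} (hK : TwoValent K) (hB : 0 ≤ B)
    (hb : BoundedBy (fun _ => B) K) : Reach 0 (2 * B) K (refineEdges K) := by
  have h0 : ∀ p j : Fin 3, 0 ≤ along p (fun t : ℤ => if t ≤ 0 then t else 2 * t - 0) j 0 := by
    intro p j
    unfold along
    split_ifs <;> simp
  -- The three directions are doubled one at a time, each down to `c = 0`.
  obtain ⟨K₁, r₁, s₁⟩ := reach_double_along (N := 2 * B) hK hb (fun _ => by omega) 0 hB le_rfl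
    (by omega)
  have b₁ := s₁.boundedBy hb (monotone_along monotone_double 0) (h0 0)
  obtain ⟨K₂, r₂, s₂⟩ := reach_double_along (N := 2 * B) (r₁.twoValent hK) b₁
    (fun j => by unfold along; split_ifs <;> simp <;> omega) 1 (c := 0)
    (by simpa [along] using hB) le_rfl (by simp [along])
  have b₂ := s₂.boundedBy b₁ (monotone_along monotone_double 1) (h0 1)
  obtain ⟨K₃, r₃, s₃⟩ := reach_double_along (N := 2 * B) (r₂.twoValent (r₁.twoValent hK)) b₂
    (fun j => by fin_cases j <;> simp [along] <;> (try split_ifs) <;> omega) 2 (c := 0)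
    (by simpa [along] using hB) le_rfl (by simp [along])
  have s := (s₁.comp s₂ (monotone_along monotone_double 0) (monotone_along monotone_double 1)).comp
    s₃ (fun j => (monotone_along monotone_double 1 j).comp (monotone_along monotone_double 0 j))
    (monotone_along monotone_double 2)
  have : K₃ = refineEdges K := by
    refine StretchOf.unique (s.congr hb fun j t ht _ => ?_) (stretchOf_refineEdges K)
    fin_cases j <;> simp [along] <;> omega
  rw [← this]
  exact (r₁.trans r₂).trans r₃

/-! ### Translating moves -/

theorem verts_image_shift (v : Point) (G : Finset Edge) :
    verts (G.image (shift v)) = (verts G).image (v + ·) := by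
  ext w
  rw [Finset.mem_image]
  constructor
  · intro h
    obtain ⟨e, he, hw⟩ := mem_verts.1 h
    obtain ⟨⟨x, q⟩, hf, rfl⟩ := Finset.mem_image.1 he
    rcases mem_ends.1 hw with rfl | rfl
    · exact ⟨x, mem_verts.2 ⟨_, hf, mem_ends.2 (Or.inl rfl)⟩, rfl⟩
    · exact ⟨x + step q, mem_verts.2 ⟨_, hf, mem_ends.2 (Or.inr rfl)⟩, (add_assoc _ _ _).symm⟩
  · rintro ⟨w, hw, rfl⟩
    obtain ⟨⟨x, q⟩, hf, hw⟩ := mem_verts.1 hw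
    refine mem_verts.2 ⟨_, Finset.mem_image_of_mem _ hf, ?_⟩
    rw [shift, mem_ends]
    rcases mem_ends.1 hw with rfl | rfl
    · exact Or.inl rfl
    · exact Or.inr (add_assoc _ _ _).symm

theorem meets_image_shift (v : Point) (K R A : Finset Edge) :
    Meets (K.image (shift v)) (R.image (shift v)) (A.image (shift v)) ↔ Meets K R A := by
  unfold Meets
  rw [← Finset.image_inter _ _ (shift_injective v),
    (Finset.image_injective (shift_injective v)).eq_iff,
    verts_image_shift, verts_image_shift, verts_image_shift,
    ← Finset.image_inter _ _ (add_right_injective v),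
    (Finset.image_injective (add_right_injective v)).eq_iff]

/-- A translation conjugates moves into moves, so a whole sequence of moves can be carried along
with its box. -/
theorem Swap.act_image_shift {s t : Swap} {v : Point} (hr : t.region = s.region.image (shift v))
    (hl : t.left = s.left.image (shift v)) (hr' : t.right = s.right.image (shift v))
    (K : Finset Edge) : t.act (K.image (shift v)) = (s.act K).image (shift v) := by
  unfold Swap.act
  rw [hr, hl, hr']
  simp only [meets_image_shift]
  split_ifs
  · rw [Finset.image_union, Finset.image_sdiff _ _ (shift_injective v)]
  · rw [Finset.image_union, Finset.image_sdiff _ _ (shift_injective v)]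
  · rfl

theorem tugSwap_act_image_shift (v a : Point) (p : Fin 3) (q : Fin 4) (K : Finset Edge) :
    (tugSwap (v + a) p q).act (K.image (shift v)) = ((tugSwap a p q).act K).image (shift v) := by
  apply Swap.act_image_shift <;>
    simp [tugSwap, faceRegion, faceEdge_shift, Finset.image_insert]

theorem wiggleSwap_act_image_shift (v a : Point) (p : Fin 3) (q : Fin 4) (K : Finset Edge) :
    (wiggleSwap (v + a) p q).act (K.image (shift v)) =
      ((wiggleSwap a p q).act K).image (shift v) := by
  apply Swap.act_image_shift <;>
    simp [wiggleSwap, faceRegion, faceEdge_shift, Finset.image_insert]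

theorem wagSwap_act_image_shift (v a : Point) (p : Fin 3) (q : Fin 4) (K : Finset Edge) :
    (wagSwap (v + a) p q).act (K.image (shift v)) = ((wagSwap a p q).act K).image (shift v) := by
  apply Swap.act_image_shift <;>
    simp [wagSwap, wagRegion, wagLeft, wagRight, faceEdge_shift, hinge_shift, Finset.image_insert,
      add_assoc]

theorem TwoValent.image_shift {K : Finset Edge} (hK : TwoValent K) (v : Point) :
    TwoValent (K.image (shift v)) := by
  intro w hw
  rw [degree_shift]
  apply hK
  by_contra h
  have h1 := degree_eq_zero.2 h
  rw [← degree_shift, degree_eq_zero] at h1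
  exact h1 hw

theorem Step.image_shift {lo hi : ℤ} {K K' : Finset Edge} (h : Step lo hi K K') (k : ℤ) :
    Step (k + lo) (k + hi) (K.image (shift fun _ => k)) (K'.image (shift fun _ => k)) := by
  obtain ⟨hK, h⟩ := h
  refine ⟨hK.image_shift _, ?_⟩
  rcases h with ⟨a, p, q, hb, h⟩ | ⟨a, p, q, hb, rfl⟩
  · refine Or.inl ⟨(fun _ => k) + a, p, q, fun j => ?_, ?_⟩
    · obtain ⟨h1, h2, h3⟩ := hb j
      rw [Pi.add_apply]
      exact ⟨by omega, by omega, fun hj => by have := h3 hj; omega⟩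
    · rw [tugSwap_act_image_shift, wiggleSwap_act_image_shift]
      exact h.imp (congrArg _) (congrArg _)
  · refine Or.inr ⟨(fun _ => k) + a, p, q, fun j => ?_, ?_⟩
    · obtain ⟨h1, h2⟩ := hb j
      rw [Pi.add_apply]
      exact ⟨by omega, by omega⟩
    · rw [wagSwap_act_image_shift]

theorem Reach.image_shift {lo hi : ℤ} {K K' : Finset Edge} (h : Reach lo hi K K') (k : ℤ) :
    Reach (k + lo) (k + hi) (K.image (shift fun _ => k)) (K'.image (shift fun _ => k)) := by
  induction h with
  | refl => exact .refl
  | tail _ h ih => exact .tail ih (h.image_shift k)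

/-! ### Orbits of the ambient groups -/

theorem coord_nonneg {ℓ : ℕ} {a : Point} {j : Fin 3} : 0 ≤ coord ℓ a j ↔ 0 ≤ a j := by
  rw [coord, le_div_iff₀ (by positivity), zero_mul, Int.cast_nonneg_iff]

theorem coord_le {ℓ n : ℕ} {a : Point} {j : Fin 3} :
    coord ℓ a j ≤ n ↔ a j ≤ ((n * 2 ^ ℓ : ℕ) : ℤ) := by
  rw [coord, div_le_iff₀ (by positivity), ← Int.cast_le (R := ℝ)]
  push_cast
  rfl

theorem coord_le_sub {ℓ n : ℕ} {a : Point} {j : Fin 3} :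
    coord ℓ a j ≤ n - 1 / 2 ^ ℓ ↔ a j + 1 ≤ ((n * 2 ^ ℓ : ℕ) : ℤ) := by
  rw [coord, le_sub_iff_add_le, ← add_div, div_le_iff₀ (by positivity), ← Int.cast_le (R := ℝ)]
  push_cast
  rfl

theorem faceInBox_iff {ℓ n : ℕ} {a : Point} {p : Fin 3} :
    FaceInBox ℓ n a p ↔
      ∀ j, 0 ≤ a j ∧ a j ≤ ((n * 2 ^ ℓ : ℕ) : ℤ) ∧ (j ≠ p → a j + 1 ≤ ((n * 2 ^ ℓ : ℕ) : ℤ)) := by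
  unfold FaceInBox
  rw [coord_nonneg, coord_nonneg, coord_nonneg, coord_le, coord_le_sub, coord_le_sub]
  constructor
  · rintro ⟨h0, h1, h2⟩ j
    have hj : ∀ p j : Fin 3, j = p ∨ j = p + 1 ∨ j = p + 2 := by decide
    rcases hj p j with rfl | rfl | rfl
    · exact ⟨h0.1, h0.2, fun h => absurd rfl h⟩
    · exact ⟨h1.1, by omega, fun _ => h1.2⟩
    · exact ⟨h2.1, by omega, fun _ => h2.2⟩
  · intro h
    have hne : ∀ p : Fin 3, p + 1 ≠ p ∧ p + 2 ≠ p := by decide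
    exact ⟨⟨(h p).1, (h p).2.1⟩, ⟨(h _).1, (h _).2.2 (hne p).1⟩, ⟨(h _).1, (h _).2.2 (hne p).2⟩⟩

theorem cubeInBox_iff {ℓ n : ℕ} {a : Point} :
    CubeInBox ℓ n a ↔ ∀ j, 0 ≤ a j ∧ a j + 1 ≤ ((n * 2 ^ ℓ : ℕ) : ℤ) := by
  unfold CubeInBox
  simp only [coord_nonneg, coord_le_sub]

theorem reach_of_mem_boundedAmbientGroup {ℓ n : ℕ} {g : Equiv.Perm (LatticeKnot ℓ)}
    (hg : g ∈ boundedAmbientGroup ℓ n) (K : LatticeKnot ℓ) :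
    Reach 0 ((n * 2 ^ ℓ : ℕ) : ℤ) K.edges (g K).edges := by
  induction hg using Subgroup.closure_induction generalizing K with
  | mem g hg =>
    refine .single ⟨K.two_valent, ?_⟩
    rcases hg with ⟨a, p, q, hb, rfl | rfl⟩ | ⟨a, p, q, hb, rfl⟩
    · exact Or.inl ⟨a, p, q, faceInBox_iff.1 hb, Or.inl rfl⟩
    · exact Or.inl ⟨a, p, q, faceInBox_iff.1 hb, Or.inr rfl⟩
    · exact Or.inr ⟨a, p, q, cubeInBox_iff.1 hb, rfl⟩
  | one => exact .refl
  | mul g h _ _ ihg ihh => exact (ihh K).trans (ihg (h K))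
  | inv g _ ih =>
    have := ih (g⁻¹ K)
    rw [show g (g⁻¹ K) = K from Equiv.apply_symm_apply g K] at this
    exact this.symm

theorem exists_mem_boundedAmbientGroup {ℓ n : ℕ} {K : LatticeKnot ℓ} {G : Finset Edge}
    (h : Reach 0 ((n * 2 ^ ℓ : ℕ) : ℤ) K.edges G) :
    ∃ g ∈ boundedAmbientGroup ℓ n, (g K).edges = G := by
  induction h with
  | refl => exact ⟨1, one_mem _, rfl⟩
  | tail _ h ih =>
    obtain ⟨g, hg, rfl⟩ := ih
    obtain ⟨-, ⟨a, p, q, hb, rfl | rfl⟩ | ⟨a, p, q, hb, rfl⟩⟩ := h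
    · exact ⟨tug ℓ a p q * g, mul_mem (Subgroup.subset_closure
        (Or.inl ⟨a, p, q, faceInBox_iff.2 hb, Or.inl rfl⟩)) hg, rfl⟩
    · exact ⟨wiggle ℓ a p q * g, mul_mem (Subgroup.subset_closure
        (Or.inl ⟨a, p, q, faceInBox_iff.2 hb, Or.inr rfl⟩)) hg, rfl⟩
    · exact ⟨wag ℓ a p q * g, mul_mem (Subgroup.subset_closure
        (Or.inr ⟨a, p, q, cubeInBox_iff.2 hb, rfl⟩)) hg, rfl⟩

theorem sameBoundedType_iff {ℓ n : ℕ} {K₁ K₂ : BoundedKnot ℓ n} :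
    SameBoundedType K₁ K₂ ↔
      Reach 0 ((n * 2 ^ ℓ : ℕ) : ℤ) K₁.toKnot.edges K₂.toKnot.edges := by
  constructor
  · rintro ⟨g, hg, h⟩
    rw [← h]
    exact reach_of_mem_boundedAmbientGroup hg _
  · intro h
    obtain ⟨g, hg, h⟩ := exists_mem_boundedAmbientGroup h
    exact ⟨g, hg, LatticeKnot.ext h⟩

/-- An element of the group is a finite word in the generators, and each generator acts in some
bounded cube. -/
theorem exists_reach_of_mem_ambientGroup {ℓ : ℕ} {g : Equiv.Perm (LatticeKnot ℓ)}
    (hg : g ∈ ambientGroup ℓ) (K : LatticeKnot ℓ) :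
    ∃ M : ℕ, Reach (-M) M K.edges (g K).edges := by
  induction hg using Subgroup.closure_induction generalizing K with
  | mem g hg =>
    obtain ⟨a, p, q, h⟩ := hg
    -- The sum of the absolute values bounds every coordinate of `a`; the additional `1` makes room
    -- for the far side of the cube.
    have hb : ∀ j, -((∑ i, (a i).natAbs + 1 : ℕ) : ℤ) ≤ a j ∧
        a j + 1 ≤ ((∑ i, (a i).natAbs + 1 : ℕ) : ℤ) := by
      intro j
      have := Finset.single_le_sum (f := fun i => (a i).natAbs) (fun _ _ => Nat.zero_le _)
        (Finset.mem_univ j)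
      omega
    have hb' : ∀ j, -((∑ i, (a i).natAbs + 1 : ℕ) : ℤ) ≤ a j ∧
        a j ≤ ((∑ i, (a i).natAbs + 1 : ℕ) : ℤ) ∧
        (j ≠ p → a j + 1 ≤ ((∑ i, (a i).natAbs + 1 : ℕ) : ℤ)) := fun j =>
      ⟨(hb j).1, by have := (hb j).2; omega, fun _ => (hb j).2⟩
    refine ⟨∑ i, (a i).natAbs + 1, .single ⟨K.two_valent, ?_⟩⟩
    rcases h with rfl | rfl | rfl
    · exact Or.inl ⟨a, p, q, hb', Or.inl rfl⟩
    · exact Or.inl ⟨a, p, q, hb', Or.inr rfl⟩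
    · exact Or.inr ⟨a, p, q, hb, rfl⟩
  | one => exact ⟨0, .refl⟩
  | mul g h _ _ ihg ihh =>
    obtain ⟨M, hM⟩ := ihh K
    obtain ⟨M', hM'⟩ := ihg (h K)
    exact ⟨M + M', (hM.mono (by omega) (by omega)).trans (hM'.mono (by omega) (by omega))⟩
  | inv g _ ih =>
    obtain ⟨M, hM⟩ := ih (g⁻¹ K)
    rw [show g (g⁻¹ K) = K from Equiv.apply_symm_apply g K] at hM
    exact ⟨M, hM.symm⟩

/-! ### Comparison of the three knot types -/

theorem BoundedKnot.boundedBy {ℓ n : ℕ} (K : BoundedKnot ℓ n) :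
    BoundedBy (fun _ => ((n * 2 ^ ℓ : ℕ) : ℤ)) K.toKnot.edges := by
  intro x q hx j
  have h1 := K.inBox x (mem_verts.2 ⟨_, hx, mem_ends.2 (Or.inl rfl)⟩) j
  have h2 := K.inBox (x + step q) (mem_verts.2 ⟨_, hx, mem_ends.2 (Or.inr rfl)⟩) j
  rw [coord_nonneg, coord_le] at h1 h2
  refine ⟨h1.1, h1.2, ?_⟩
  rintro rfl
  rw [Pi.add_apply, step_self] at h2
  exact h2.2

theorem toKnot_iotaPow {ℓ n : ℕ} (K : BoundedKnot ℓ n) (k : ℕ) :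
    (iotaPow K k).toKnot = K.toKnot := by
  induction k with
  | zero => rfl
  | succ k ih => exact ih

theorem toKnot_refinePow {ℓ n : ℕ} (K : BoundedKnot ℓ n) (k : ℕ) :
    (K.refinePow k).toKnot = LatticeKnots.refinePow K.toKnot k := by
  induction k with
  | zero => rfl
  | succ k ih => exact congrArg LatticeKnots.refine ih

/-- Numerators double with each refinement, so the box needed for step `k` is exactly the original
box `[0, n]³` seen at order `ℓ + k`. -/
theorem reach_refinePow {ℓ n : ℕ} (K : BoundedKnot ℓ n) (k : ℕ) :
    Reach 0 ((n * 2 ^ (ℓ + k) : ℕ) : ℤ) K.toKnot.edges (K.refinePow k).toKnot.edges := by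
  induction k with
  | zero => exact .refl
  | succ k ih =>
    have h := reach_refineEdges (K.refinePow k).toKnot.two_valent (Int.natCast_nonneg _)
      (K.refinePow k).boundedBy
    have e : (2 : ℤ) * ((n * 2 ^ (ℓ + k) : ℕ) : ℤ) = ((n * 2 ^ (ℓ + (k + 1)) : ℕ) : ℤ) := by
      push_cast
      ring
    rw [e] at h
    refine (ih.mono le_rfl ?_).trans h
    rw [← e]
    have := Int.natCast_nonneg (n * 2 ^ (ℓ + k))
    omega

theorem sameTypeBoxLimit_iff {ℓ n : ℕ} {K₁ K₂ : BoundedKnot ℓ n} :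
    SameTypeBoxLimit K₁ K₂ ↔
      ∃ N : ℕ, Reach 0 N K₁.toKnot.edges K₂.toKnot.edges := by
  unfold SameTypeBoxLimit
  simp only [sameBoundedType_iff, toKnot_iotaPow]
  constructor
  · rintro ⟨n', h⟩
    exact ⟨_, h⟩
  · rintro ⟨N, h⟩
    refine ⟨N, h.mono le_rfl ?_⟩
    have h1 : N ≤ (n + N) * 2 ^ ℓ :=
      (Nat.le_add_left N n).trans (Nat.le_mul_of_pos_right _ (by positivity))
    exact_mod_cast h1

theorem SameTypeBoxLimit.sameTypeOrderLimit {ℓ n : ℕ} {K₁ K₂ : BoundedKnot ℓ n}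
    (h : SameTypeBoxLimit K₁ K₂) : SameTypeOrderLimit K₁ K₂ := by
  -- A box of side `0` does not grow in numerators under refinement, but it contains no edge, so
  -- both knots are empty.
  rcases Nat.eq_zero_or_pos n with rfl | hn
  · have hempty : ∀ K : BoundedKnot ℓ 0, K.toKnot.edges = ∅ := by
      intro K
      refine Finset.eq_empty_of_forall_notMem ?_
      rintro ⟨x, q⟩ hx
      have := K.boundedBy x q hx q
      have h1 := this.2.2 rfl
      rw [zero_mul] at h1
      push_cast at h1
      omega
    refine ⟨0, sameBoundedType_iff.2 ?_⟩
    change Reach _ _ K₁.toKnot.edges K₂.toKnot.edges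
    rw [hempty, hempty]
  · obtain ⟨N, h⟩ := sameTypeBoxLimit_iff.1 h
    -- Refining `N` times suffices since `N ≤ 2 ^ N`.
    refine ⟨N, sameBoundedType_iff.2 ?_⟩
    have hN : N ≤ n * 2 ^ (ℓ + N) := by
      calc N ≤ 2 ^ N := Nat.lt_two_pow_self.le
        _ ≤ 2 ^ (ℓ + N) := Nat.pow_le_pow_right (by norm_num) (by omega)
        _ ≤ n * 2 ^ (ℓ + N) := Nat.le_mul_of_pos_left _ hn
    exact ((reach_refinePow K₁ N).symm.trans (h.mono le_rfl (by exact_mod_cast hN))).trans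
      (reach_refinePow K₂ N)

theorem SameTypeOrderLimit.sameKnotType {ℓ n : ℕ} {K₁ K₂ : BoundedKnot ℓ n}
    (h : SameTypeOrderLimit K₁ K₂) : SameKnotType K₁.toKnot K₂.toKnot := by
  obtain ⟨k, g, hg, h⟩ := h
  rw [toKnot_refinePow, toKnot_refinePow] at h
  exact ⟨k, g, boundedAmbientGroup_le _ _ hg, h⟩

theorem SameKnotType.sameTypeBoxLimit {ℓ n : ℕ} {K₁ K₂ : BoundedKnot ℓ n}
    (h : SameKnotType K₁.toKnot K₂.toKnot) : SameTypeBoxLimit K₁ K₂ := by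
  obtain ⟨m, g, hg, h⟩ := h
  obtain ⟨M, hM⟩ := exists_reach_of_mem_ambientGroup hg (refinePow K₁.toKnot m)
  rw [h, ← toKnot_refinePow, ← toKnot_refinePow] at hM
  set B : ℕ := n * 2 ^ (ℓ + m)
  -- The cube of radius `M + B` contains the given moves as well as those joining the two knots to
  -- their refinements.
  have hr : Reach (-(M + B : ℕ)) (M + B : ℕ) K₁.toKnot.edges K₂.toKnot.edges :=
    (((reach_refinePow K₁ m).mono (by omega) (by omega)).trans
      (hM.mono (by omega) (by omega))).trans
      ((reach_refinePow K₂ m).symm.mono (by omega) (by omega))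
  have hB : n * 2 ^ ℓ ≤ B :=
    Nat.mul_le_mul_left _ (Nat.pow_le_pow_right (by norm_num) (by omega))
  -- Translation by `M + B` carries the centred cube to the one with side `2 * (M + B)` in the
  -- positive octant. The translated knots fit there because `n * 2 ^ ℓ ≤ B`.
  have ht : ∀ K : BoundedKnot ℓ n, Reach 0 (2 * (M + B) : ℕ) K.toKnot.edges
      (K.toKnot.edges.image (shift fun _ => ((M + B : ℕ) : ℤ))) := fun K =>
    reach_image_shift_diagonal K.toKnot.two_valent (Int.natCast_nonneg _) K.boundedBy _
      (by omega)
  have hs := hr.image_shift ((M + B : ℕ) : ℤ)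
  exact sameTypeBoxLimit_iff.2 ⟨2 * (M + B),
    ((ht K₁).trans (hs.mono (by omega) (by omega))).trans (ht K₂).symm⟩

end LatticeKnots

theorem mainTheorem8 (ℓ n : ℕ) (K₁ K₂ : LatticeKnots.BoundedKnot ℓ n) :
    (LatticeKnots.SameTypeBoxLimit K₁ K₂ ↔ LatticeKnots.SameTypeOrderLimit K₁ K₂) ∧
      (LatticeKnots.SameTypeOrderLimit K₁ K₂ ↔
        LatticeKnots.SameKnotType K₁.toKnot K₂.toKnot) :=
  ⟨⟨fun h => h.sameTypeOrderLimit, fun h => h.sameKnotType.sameTypeBoxLimit⟩,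
    ⟨fun h => h.sameKnotType, fun h => h.sameTypeBoxLimit.sameTypeOrderLimit⟩⟩
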